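/- Let $\mathfrak A$ be a real (or complex) Banach algebra, for instance the $d\times d$ matrices, and let $A:\mathbb R\to\mathfrak A$ be given near $t=0$ by a convergent power series. The Magnus series of $A$ is $\Omega(t)=\sum_{n\ge1}\Omega_n(t)$, where $\Omega_n(t)=\int_0^t\dot\Omega_n(s)\,ds$ and the $\dot\Omega_n$ are defined recursively by $$\dot\Omega_1=A,\qquad \dot\Omega_n=-\sum_{m=1}^{n-1}\frac1{(m+1)!}\sum_{\substack{n_1,\dots,n_m,k\ge1\\ n_1+\dots+n_m+k=n}}[\Omega_{n_1},[\Omega_{n_2},\dots,[\Omega_{n_m},\dot\Omega_k]\dots]]\qquad(n\ge2).$$ For all $t$ in a neighbourhood of $0$ this series converges, and $U(t)=\exp\Omega(t)$ is the propagator of $A$: $\Omega(0)=0$ and $\frac{d}{dt}e^{\Omega(t)}=A(t)e^{\Omega(t)}$. Let $P_n$ be the shifted Legendre polynomials on $[0,1]$, normalized by $P_n(1)=1$ (so $P_0=1$, $P_1(x)=2x-1$, $P_2(x)=6x^2-6x+1$, $P_3(x)=20x^3-30x^2+12x-1$), and let $$A_n=A_n(\delta t)=(2n-1)\int_0^{\delta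 t}A(t)\,P_{n-1}(t/\delta t)\,dt$$ be the coefficients of the expansion $A(t)=\frac1{\delta t}\sum_{n\ge1}A_nP_{n-1}(t/\delta t)$ on $[0,\delta t]$. Then, as $\delta t\to0$, $$\begin{aligned} \Omega(\delta t)={}&A_1-\tfrac16[A_1,A_2]\\ &+\tfrac1{60}[A_1,[A_1,A_3]]-\tfrac1{60}[A_2,[A_1,A_2]]+\tfrac1{360}[A_1,[A_1,[A_1,A_2]]]-\tfrac1{30}[A_2,A_3]\\ &-\tfrac1{70}[A_3,A_4]+\tfrac1{140}[A_2,[A_1,A_4]]-\tfrac1{210}[A_2,[A_2,A_3]]-\tfrac1{420}[A_3,[A_1,A_3]]-\tfrac1{210}[A_4,[A_1,A_2]]\\ &-\tfrac1{840}[A_1,[A_1,[A_1,A_4]]]-\tfrac1{504}[[A_1,A_2],[A_1,A_3]]+\tfrac1{504}[A_2,[A_1,[A_1,A_3]]]-\tfrac1{840}[A_2,[A_2,[A_1,A_2]]]\\ &+\tfrac1{2520}[A_3,[A_1,[A_1,A_2]]]-\tfrac1{2520}[A_1,[A_1,[A_1,[A_1,A_3]]]]-\tfrac1{7560}[[A_1,A_2],[A_1,[A_1,A_2]]]\\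 &+\tfrac1{2520}[A_2,[A_1,[A_1,[A_1,A_2]]]]-\tfrac1{15120}[A_1,[A_1,[A_1,[A_1,[A_1,A_2]]]]]+O(\delta t^{9}). \end{aligned}$$ -/

import Mathlib

open Filter Topology
open scoped Nat

noncomputable section

/-- The shifted Legendre polynomial `P_n` on `[0,1]`, normalized by `P_n(1) = 1`
(Mathlib's `Polynomial.shiftedLegendre n` is `(-1)^n P_n`). -/
def legendreP (n : ℕ) (x : ℝ) : ℝ :=
  (-1) ^ n * Polynomial.aeval x (Polynomial.shiftedLegendre n)

theorem legendreP_zero (x : ℝ) : legendreP 0 x = 1 := by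
  simp [legendreP, Polynomial.shiftedLegendre]

theorem legendreP_one (x : ℝ) : legendreP 1 x = 2 * x - 1 := by
  simp [legendreP, Polynomial.shiftedLegendre, Finset.sum_range_succ]
  ring

theorem legendreP_two (x : ℝ) : legendreP 2 x = 6 * x ^ 2 - 6 * x + 1 := by
  simp [legendreP, Polynomial.shiftedLegendre, Finset.sum_range_succ, Nat.choose, map_ofNat]
  ring

theorem legendreP_three (x : ℝ) :
    legendreP 3 x = 20 * x ^ 3 - 30 * x ^ 2 + 12 * x - 1 := by
  simp [legendreP, Polynomial.shiftedLegendre, Finset.sum_range_succ, Nat.choose, map_ofNat]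
  ring

/-- The Legendre coefficient `A_n = (2n-1) ∫_0^δ A(t) P_{n-1}(t/δ) dt` (for `n ≥ 1`) of `A` on
the interval `[0,δ]`. -/
def legendreCoeff {𝔸 : Type*} [NormedRing 𝔸] [NormedAlgebra ℝ 𝔸]
    (A : ℝ → 𝔸) (δ : ℝ) (n : ℕ) : 𝔸 :=
  (2 * (n : ℝ) - 1) • ∫ t in (0 : ℝ)..δ, legendreP (n - 1) (t / δ) • A t

/-- The right-nested commutator `[x_0,[x_1,…,[x_{m-1}, y]…]]`. -/
def nestedComm {𝔸 : Type*} [Ring 𝔸] {m : ℕ} (x : Fin m → 𝔸) (y : 𝔸) : 𝔸 :=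
  (List.ofFn x).foldr (fun a b => ⁅a, b⁆) y

/-- The tuples `(n_0, …, n_m)` of integers `n_i ≥ 1` with `n_0 + … + n_m = n`. -/
def positiveTuples (m n : ℕ) : Finset (Fin (m + 1) → ℕ) :=
  (Finset.Nat.antidiagonalTuple (m + 1) n).filter fun v => ∀ i, 1 ≤ v i

/-- The right-hand side of the recursion for the derivative of the `n`-th Magnus term, where
`D k` stands for the derivative of the `k`-th term, so that the `k`-th term is `∫_0^t D k`. -/
def magnusStep {𝔸 : Type*} [NormedRing 𝔸] [NormedAlgebra ℝ 𝔸]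
    (A : ℝ → 𝔸) (D : ℕ → ℝ → 𝔸) (n : ℕ) (t : ℝ) : 𝔸 :=
  if n = 1 then A t else
    -∑ m ∈ Finset.Icc 1 (n - 1), (1 / ((m + 1)! : ℝ)) •
      ∑ v ∈ positiveTuples m n,
        nestedComm (fun i : Fin m => ∫ s in (0 : ℝ)..t, D (v i.castSucc) s) (D (v (Fin.last m)) t)

/-- The derivative of the `n`-th term of the Magnus series (`n ≥ 1`), by strong recursion on `n`;
`magnusDot_one` and `magnusDot_of_two_le` give the recursion in its usual form. -/
def magnusDot {𝔸 : Type*} [NormedRing 𝔸] [NormedAlgebra ℝ 𝔸]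
    (A : ℝ → 𝔸) (n : ℕ) : ℝ → 𝔸 :=
  magnusStep A (fun k => if _h : k < n then magnusDot A k else 0) n
termination_by n

/-- The `n`-th term `Ω_n` of the Magnus series (`n ≥ 1`). -/
def magnusTerm {𝔸 : Type*} [NormedRing 𝔸] [NormedAlgebra ℝ 𝔸]
    (A : ℝ → 𝔸) (n : ℕ) (t : ℝ) : 𝔸 :=
  ∫ s in (0 : ℝ)..t, magnusDot A n s

/-- The sum `Ω(t) = ∑_{n ≥ 1} Ω_n(t)` of the Magnus series. -/
def magnusSeries {𝔸 : Type*} [NormedRing 𝔸] [NormedAlgebra ℝ 𝔸]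
    (A : ℝ → 𝔸) (t : ℝ) : 𝔸 :=
  ∑' n : ℕ, magnusTerm A (n + 1) t

theorem magnusDot_one {𝔸 : Type*} [NormedRing 𝔸] [NormedAlgebra ℝ 𝔸] (A : ℝ → 𝔸) :
    magnusDot A 1 = A := by
  rw [magnusDot]
  funext t
  simp [magnusStep]

theorem lt_of_mem_positiveTuples {m n : ℕ} (hm : 1 ≤ m) {v : Fin (m + 1) → ℕ}
    (hv : v ∈ positiveTuples m n) (i : Fin (m + 1)) : v i < n := by
  obtain ⟨hs, hpos⟩ := Finset.mem_filter.1 hv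
  rw [Finset.Nat.mem_antidiagonalTuple] at hs
  have hne : ∃ j : Fin (m + 1), j ≠ i := by
    have : Nontrivial (Fin (m + 1)) := Fin.nontrivial_iff_two_le.2 (by omega)
    exact exists_ne i
  obtain ⟨j, hj⟩ := hne
  have h := Finset.add_le_sum (f := v) (s := Finset.univ) (fun k _ => Nat.zero_le _)
    (Finset.mem_univ i) (Finset.mem_univ j) hj.symm
  have := hpos j
  omega

theorem magnusDot_of_two_le {𝔸 : Type*} [NormedRing 𝔸] [NormedAlgebra ℝ 𝔸]
    (A : ℝ → 𝔸) {n : ℕ} (hn : 2 ≤ n) (t : ℝ) :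
    magnusDot A n t = -∑ m ∈ Finset.Icc 1 (n - 1), (1 / ((m + 1)! : ℝ)) •
      ∑ v ∈ positiveTuples m n,
        nestedComm (fun i : Fin m => magnusTerm A (v i.castSucc) t)
          (magnusDot A (v (Fin.last m)) t) := by
  rw [magnusDot, magnusStep, if_neg (by omega)]
  congr 1
  refine Finset.sum_congr rfl fun m hm => ?_
  congr 1
  refine Finset.sum_congr rfl fun v hv => ?_
  have h := lt_of_mem_positiveTuples (Finset.mem_Icc.1 hm).1 hv
  simp only [h, dif_pos, magnusTerm]

/-- The truncated Magnus expansion in the first four Legendre coefficients `a, b, c, d`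
(that is, `A_1, A_2, A_3, A_4`). -/
def magnusLegendre {𝔸 : Type*} [NormedRing 𝔸] [NormedAlgebra ℝ 𝔸] (a b c d : 𝔸) : 𝔸 :=
  a - (1 / 6 : ℝ) • ⁅a, b⁆
  + (1 / 60 : ℝ) • ⁅a, ⁅a, c⁆⁆ - (1 / 60 : ℝ) • ⁅b, ⁅a, b⁆⁆
  + (1 / 360 : ℝ) • ⁅a, ⁅a, ⁅a, b⁆⁆⁆ - (1 / 30 : ℝ) • ⁅b, c⁆
  - (1 / 70 : ℝ) • ⁅c, d⁆ + (1 / 140 : ℝ) • ⁅b, ⁅a, d⁆⁆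
  - (1 / 210 : ℝ) • ⁅b, ⁅b, c⁆⁆ - (1 / 420 : ℝ) • ⁅c, ⁅a, c⁆⁆
  - (1 / 210 : ℝ) • ⁅d, ⁅a, b⁆⁆
  - (1 / 840 : ℝ) • ⁅a, ⁅a, ⁅a, d⁆⁆⁆ - (1 / 504 : ℝ) • ⁅⁅a, b⁆, ⁅a, c⁆⁆
  + (1 / 504 : ℝ) • ⁅b, ⁅a, ⁅a, c⁆⁆⁆ - (1 / 840 : ℝ) • ⁅b, ⁅b, ⁅a, b⁆⁆⁆
  + (1 / 2520 : ℝ) • ⁅c, ⁅a, ⁅a, b⁆⁆⁆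
  - (1 / 2520 : ℝ) • ⁅a, ⁅a, ⁅a, ⁅a, c⁆⁆⁆⁆ - (1 / 7560 : ℝ) • ⁅⁅a, b⁆, ⁅a, ⁅a, b⁆⁆⁆
  + (1 / 2520 : ℝ) • ⁅b, ⁅a, ⁅a, ⁅a, b⁆⁆⁆⁆
  - (1 / 15120 : ℝ) • ⁅a, ⁅a, ⁅a, ⁅a, ⁅a, b⁆⁆⁆⁆⁆

end

/-! Write `U = exp Ω`, and let `θ` be the truncated expression in `A_1, …, A_4`. The Magnus
recursion says that, for `n ≥ 2`, the degree `n` part of `dexp Ω Ω' = ∑ ad_Ω^m Ω' / (m+1)!`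
vanishes, and that the degree one part is `A`. Once a majorant gives absolute convergence, summing
over `n` yields `dexp Ω Ω' = A` (`dexp_tsum_eq`), and the formula `(exp Ω)' = dexp Ω Ω' * exp Ω`
(`HasDerivAt.normedSpace_exp`) gives `U' = A U`.

The expansion is then checked on exponentials, without computing any `Ω_n`. Modulo `O(δ^9)`, `exp θ`
is a polynomial `F` in `δ` whose coefficients are noncommutative polynomials in the Taylor
coefficients of `A`. That `δ F' = δ A F` up to weight 8 is a finite identity in the free algebra,
decided by computation (`euler_truncExp_magnusTree`), so it holds in every Banach algebra. Variation
of constants turns this into `F - exp Ω = O(δ^9)` (`exp_magnusSeries_sub_propagatorJet_isBigO`).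
Hence `exp θ - exp Ω = O(δ^9)`, and since `exp` is strictly differentiable at `0` with derivative
the identity, the same bound holds for `θ - Ω` (`isBigO_sub_of_isBigO_exp_sub`). -/

noncomputable section

/-! ### Computation in the truncated free algebra. -/

/-- Noncommutative polynomials without constant term in letters `0, 1, 2, …` of weights
`1, 2, 3, …`. A node at depth `j` stands for `letter j * (c + o) + z`, where `o` starts again at depth `0` and
`z` is at depth `j + 1`; the number of steps from the root is thus the weight. -/
inductive WordTree
  | nil
  | node (c : ℤ) (o z : WordTree)

namespace WordTree

def add : WordTree → WordTree → WordTree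
  | nil, t => t
  | node c o z, nil => node c o z
  | node c o z, node c' o' z' => node (c + c') (add o o') (add z z')

/-- Multiplication of all coefficients by `k`. -/
def smul (k : ℤ) : WordTree → WordTree
  | nil => nil
  | node c o z => node (k * c) (smul k o) (smul k z)

/-- Truncation at weight `n`. -/
def trunc : ℕ → WordTree → WordTree
  | 0, _ => nil
  | _ + 1, nil => nil
  | n + 1, node c o z => node c (trunc n o) (trunc n z)

/-- The product, truncated at weight `n`. -/
def mul : ℕ → WordTree → WordTree → WordTree
  | 0, _, _ => nil
  | _ + 1, nil, _ => nil
  | n + 1, node c o z, g => node 0 (add (smul c (trunc n g)) (mul n o g)) (mul n z g)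

/-- The commutator, truncated at weight `8`. -/
def bracket (f g : WordTree) : WordTree := add (mul 8 f g) (smul (-1) (mul 8 g f))

/-- Multiplication of every coefficient by the weight of its word, shifted by `j`. -/
def euler : ℕ → WordTree → WordTree
  | _, nil => nil
  | j, node c o z => node ((j + 1 : ℕ) * c) (euler (j + 1) o) (euler (j + 1) z)

/-- The linear combination of the letters `j, …, j + n - 1` with coefficients `f`. -/
def letters (f : ℕ → ℤ) : ℕ → ℕ → WordTree
  | 0, _ => nil
  | n + 1, j => node (f j) nil (letters f n (j + 1))

/-- Whether all coefficients vanish. -/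
def isZero : WordTree → Bool
  | nil => true
  | node c o z => decide (c = 0) && isZero o && isZero z

/-- `(2 n - 1) ∫_0^1 x ^ k P_{n-1}(x) dx`, times `2310 ^ (k + 1)` to make it an integer. -/
def legendreWeight (n k : ℕ) : ℕ :=
  (2 * n - 1) * k.descFactorial (n - 1) * 2310 ^ (k + 1) / (k + 1).ascFactorial n

/-- The `n`-th Legendre coefficient. -/
def legendreTree (n : ℕ) : WordTree := letters (fun k => legendreWeight n k) 8 0

/-- `15120` times the truncated Magnus expansion. -/
def magnusTree : WordTree :=
  let a := legendreTree 1
  let b := legendreTree 2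
  let c := legendreTree 3
  let d := legendreTree 4
  add (smul 15120 a) <| add (smul (-2520) (bracket a b)) <|
  add (smul 252 (bracket a (bracket a c))) <| add (smul (-252) (bracket b (bracket a b))) <|
  add (smul 42 (bracket a (bracket a (bracket a b)))) <| add (smul (-504) (bracket b c)) <|
  add (smul (-216) (bracket c d)) <| add (smul 108 (bracket b (bracket a d))) <|
  add (smul (-72) (bracket b (bracket b c))) <| add (smul (-36) (bracket c (bracket a c))) <|
  add (smul (-72) (bracket d (bracket a b))) <|
  add (smul (-18) (bracket a (bracket a (bracket a d)))) <|
  add (smul (-30) (bracket (bracket a b) (bracket a c))) <|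
  add (smul 30 (bracket b (bracket a (bracket a c)))) <|
  add (smul (-18) (bracket b (bracket b (bracket a b)))) <|
  add (smul 6 (bracket c (bracket a (bracket a b)))) <|
  add (smul (-6) (bracket a (bracket a (bracket a (bracket a c))))) <|
  add (smul (-2) (bracket (bracket a b) (bracket a (bracket a b)))) <|
  add (smul 6 (bracket b (bracket a (bracket a (bracket a b))))) <|
  smul (-1) (bracket a (bracket a (bracket a (bracket a (bracket a b)))))

/-- `∑_{k=1}^8 (8!/k!) 15120^(8-k) S^k` by Horner's scheme, when `m = 7`. -/
def truncExp (S : WordTree) : ℕ → WordTree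
  | 0 => S
  | m + 1 => add (smul (Nat.descFactorial 8 (m + 1) * 15120 ^ (m + 1)) S) (mul 8 S (truncExp S m))

/-- The expansion of `δ • A δ`. -/
def generatorTree : WordTree := letters (fun k => 2310 ^ (k + 1)) 8 0

/-- With `E = 8! 15120^8 (exp θ - 1)`, this is `δ E' = δ A (8! 15120^8 + E)` up to weight 8, that
is, the propagator equation for `exp θ`. Scaling by `15120` and `8!` clears all denominators, so
only integer coefficients are compared. -/
theorem euler_truncExp_magnusTree :
    isZero (add (euler 0 (truncExp magnusTree 7))
      (smul (-1) (add (smul (Nat.descFactorial 8 8 * 15120 ^ 8) generatorTree)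
        (mul 8 generatorTree (truncExp magnusTree 7))))) = true := by
  decide +kernel

/-! ### Evaluation of trees in a normed algebra. -/

section Eval

variable {𝔸 : Type*} [NormedRing 𝔸] [NormedAlgebra ℝ 𝔸] (x : ℕ → 𝔸)

/-- The value of a tree at depth `j`, the letter `k` standing for `δ ^ (k + 1) • x k`. -/
def eval (x : ℕ → 𝔸) (δ : ℝ) : ℕ → WordTree → 𝔸
  | _, nil => 0
  | j, node c o z => δ ^ (j + 1) • (x j * ((c : ℝ) • 1 + eval x δ 0 o)) + eval x δ (j + 1) z

theorem eval_add (δ : ℝ) (s t : WordTree) (j : ℕ) :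
    eval x δ j (add s t) = eval x δ j s + eval x δ j t := by
  induction s generalizing t j with
  | nil => simp [add, eval]
  | node c o z iho ihz =>
    cases t with
    | nil => simp [add, eval]
    | node c' o' z' =>
      simp only [add, eval, iho, ihz, Int.cast_add, add_smul, mul_add, smul_add]
      abel

theorem eval_smul (δ : ℝ) (k : ℤ) (t : WordTree) (j : ℕ) :
    eval x δ j (smul k t) = (k : ℝ) • eval x δ j t := by
  induction t generalizing j with
  | nil => simp [smul, eval]
  | node c o z iho ihz =>
    simp only [smul, eval, iho, ihz, Int.cast_mul, mul_smul, smul_add, mul_add, mul_smul_comm,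
      smul_comm (k : ℝ) (δ ^ (j + 1))]

theorem eval_of_isZero (δ : ℝ) (t : WordTree) (ht : isZero t = true) (j : ℕ) :
    eval x δ j t = 0 := by
  induction t generalizing j with
  | nil => rfl
  | node c o z iho ihz =>
    simp only [isZero, Bool.and_eq_true, decide_eq_true_eq] at ht
    simp [eval, ht.1.1, iho ht.1.2, ihz ht.2]

theorem eval_letters (δ : ℝ) (f : ℕ → ℤ) (n j : ℕ) :
    eval x δ j (letters f n j) =
      ∑ k ∈ Finset.range n, δ ^ (j + k + 1) • ((f (j + k) : ℝ) • x (j + k)) := by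
  induction n generalizing j with
  | zero => simp [letters, eval]
  | succ n ih =>
    rw [Finset.sum_range_succ', letters, eval, ih]
    simp [eval, add_comm, add_left_comm]

theorem isBigO_pow_smul_mul {f : ℝ → 𝔸} {m k n : ℕ} (a : 𝔸)
    (hf : f =O[𝓝 0] fun δ : ℝ => δ ^ m) (hn : n = k + m) :
    (fun δ : ℝ => δ ^ k • (a * f δ)) =O[𝓝 0] fun δ : ℝ => δ ^ n := by
  have h1 : (fun δ : ℝ => a * f δ) =O[𝓝 0] fun δ : ℝ => δ ^ m := hf.const_mul_left a
  have h2 := (Asymptotics.isBigO_refl (fun δ : ℝ => δ ^ k) (𝓝 0)).smul h1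
  simpa [hn, pow_add] using h2

theorem isBigO_pow_of_le {n m : ℕ} (h : m ≤ n) :
    (fun δ : ℝ => δ ^ n) =O[𝓝 0] fun δ : ℝ => δ ^ m :=
  Asymptotics.IsBigO.of_bound 1 <| by
    filter_upwards [Metric.closedBall_mem_nhds (0 : ℝ) one_pos] with δ hδ
    rw [norm_pow, norm_pow, one_mul]
    exact pow_le_pow_of_le_one (norm_nonneg _) (by simpa using hδ) h

theorem eval_isBigO (t : WordTree) (j : ℕ) :
    (fun δ : ℝ => eval x δ j t) =O[𝓝 0] fun δ : ℝ => δ ^ (j + 1) := by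
  induction t generalizing j with
  | nil => simpa [eval] using Asymptotics.isBigO_zero _ _
  | node c o z iho ihz =>
    simp only [eval]
    refine .add (isBigO_pow_smul_mul (m := 0) _ ?_ rfl)
      ((ihz (j + 1)).trans (isBigO_pow_of_le (by omega)))
    refine .add ?_ ((iho 0).trans (isBigO_pow_of_le (by omega)))
    simpa using Asymptotics.isBigO_const_const ((c : ℝ) • (1 : 𝔸)) (one_ne_zero (α := ℝ)) (𝓝 0)

/-- At depth `j` every word has weight at least `j + 1`, so keeping `n` levels discards only weights
from `n + j + 1` on. The same count governs products. -/
theorem eval_trunc (t : WordTree) (n j : ℕ) :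
    (fun δ : ℝ => eval x δ j (trunc n t) - eval x δ j t) =O[𝓝 0]
      fun δ : ℝ => δ ^ (n + j + 1) := by
  induction n generalizing t j with
  | zero => simpa [trunc, eval] using (eval_isBigO x t j).neg_left
  | succ n ih =>
    cases t with
    | nil => simpa [trunc, eval] using Asymptotics.isBigO_zero _ _
    | node c o z =>
      have h1 := isBigO_pow_smul_mul (k := j + 1) (x j) (ih o 0) rfl
      refine ((h1.trans (isBigO_pow_of_le ?_)).add ((ih z (j + 1)).trans
        (isBigO_pow_of_le ?_))).congr_left fun δ => ?_
      · omega
      · omega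
      · simp only [trunc, eval, mul_sub, mul_add, smul_sub, smul_add]
        abel

theorem eval_mul (f g : WordTree) (n j : ℕ) :
    (fun δ : ℝ => eval x δ j (mul n f g) - eval x δ j f * eval x δ 0 g) =O[𝓝 0]
      fun δ : ℝ => δ ^ (n + j + 1) := by
  induction n generalizing f j with
  | zero =>
    have h := (eval_isBigO x f j).mul ((eval_isBigO x g 0).trans (isBigO_pow_of_le (Nat.zero_le _)))
    simpa [mul, eval] using h
  | succ n ih =>
    cases f with
    | nil => simpa [mul, eval] using Asymptotics.isBigO_zero _ _
    | node c o z =>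
      have h1 := isBigO_pow_smul_mul (k := j + 1) (x j)
        (((eval_trunc x g n 0).const_smul_left (c : ℝ)).add (ih o 0)) rfl
      refine ((h1.trans (isBigO_pow_of_le ?_)).add ((ih z (j + 1)).trans
        (isBigO_pow_of_le ?_))).congr_left fun δ => ?_
      · omega
      · omega
      · simp only [mul, eval, eval_add, eval_smul, Int.cast_zero, zero_smul, zero_add, mul_sub,
          mul_add, add_mul, smul_sub, smul_add, Pi.smul_apply, smul_mul_assoc, mul_smul_comm,
          mul_one, mul_assoc]
        abel

theorem contDiff_eval (t : WordTree) (j : ℕ) : ContDiff ℝ 1 fun δ : ℝ => eval x δ j t := by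
  induction t generalizing j with
  | nil => exact contDiff_const
  | node c o z iho ihz =>
    simp only [eval]
    exact ((contDiff_id.pow _).smul (contDiff_const.mul (contDiff_const.add (iho 0)))).add
      (ihz (j + 1))

/-- A word of weight `k` carries `δ ^ k`, on which `δ d/dδ` acts as multiplication by `k`. The
offset `w` is needed for the induction: the subtree `o` restarts at depth `0`, while `euler` still
counts the weight of the prefix already read. -/
theorem eval_euler_add (t : WordTree) (w j : ℕ) (δ : ℝ) :
    eval x δ j (euler (w + j) t) =
      δ • deriv (fun δ : ℝ => eval x δ j t) δ + (w : ℝ) • eval x δ j t := by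
  have hd (t : WordTree) (j : ℕ) : HasDerivAt (fun δ : ℝ => eval x δ j t)
      (deriv (fun δ : ℝ => eval x δ j t) δ) δ :=
    ((contDiff_eval x t j).differentiable one_ne_zero δ).hasDerivAt
  induction t generalizing w j with
  | nil => simp [euler, eval]
  | node c o z iho ihz =>
    have h := ((hasDerivAt_pow (j + 1) δ).fun_smul (((hd o 0).const_add
      ((c : ℝ) • (1 : 𝔸))).const_mul (x j))).fun_add (hd z (j + 1))
    have hz : eval x δ (j + 1) (euler (w + j + 1) z) = _ := ihz w (j + 1)
    have ho : eval x δ 0 (euler (w + j + 1) o) = _ := iho (w + j + 1) 0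
    simp only [euler, eval]
    rw [h.deriv, hz, ho]
    simp only [Nat.add_sub_cancel, pow_succ, smul_add, mul_add, mul_smul_comm]
    push_cast
    module

theorem smul_deriv_eval (t : WordTree) (j : ℕ) (δ : ℝ) :
    δ • deriv (fun δ : ℝ => eval x δ j t) δ = eval x δ j (euler j t) := by
  simpa using (eval_euler_add x t 0 j δ).symm

end Eval

end WordTree

/-! ### Calculus of expansions modulo `O(δ^9)`. -/

namespace WordTree

section Represents

variable {𝔸 : Type*} [NormedRing 𝔸] [NormedAlgebra ℝ 𝔸] {x : ℕ → 𝔸}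

/-- The tree `t` gives the expansion of `f` at `0` up to `O(δ ^ 9)`. -/
def Represents (x : ℕ → 𝔸) (f : ℝ → 𝔸) (t : WordTree) : Prop :=
  (fun δ => f δ - eval x δ 0 t) =O[𝓝 0] fun δ : ℝ => δ ^ 9

namespace Represents

variable {f g : ℝ → 𝔸} {s t : WordTree}

theorem isBigO_id (hf : Represents x f s) : f =O[𝓝 0] fun δ : ℝ => δ := by
  have h1 : (fun δ : ℝ => δ ^ 9) =O[𝓝 0] fun δ : ℝ => δ ^ 1 := isBigO_pow_of_le (by norm_num)
  simpa using (hf.trans h1).add (eval_isBigO x s 0)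

theorem isBigO_one (hf : Represents x f s) : f =O[𝓝 0] fun _ : ℝ => (1 : ℝ) := by
  have h1 : (fun δ : ℝ => δ ^ 1) =O[𝓝 0] fun δ : ℝ => δ ^ 0 := isBigO_pow_of_le (by norm_num)
  refine hf.isBigO_id.trans ?_
  simpa using h1

theorem congr (hf : Represents x f s) (h : ∀ δ, f δ = g δ) : Represents x g s :=
  funext h ▸ hf

theorem add (hf : Represents x f s) (hg : Represents x g t) :
    Represents x (fun δ => f δ + g δ) (s.add t) := by
  refine (Asymptotics.IsBigO.add hf hg).congr_left fun δ => ?_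
  simp only [eval_add]
  abel

theorem smul (hf : Represents x f s) (k : ℤ) :
    Represents x (fun δ => (k : ℝ) • f δ) (s.smul k) := by
  refine (Asymptotics.IsBigO.const_smul_left hf (k : ℝ)).congr_left fun δ => ?_
  rw [eval_smul, Pi.smul_apply, smul_sub]

theorem mul (hf : Represents x f s) (hg : Represents x g t) :
    Represents x (fun δ => f δ * g δ) (s.mul 8 t) := by
  have hs : (fun δ => eval x δ 0 s) =O[𝓝 0] fun _ : ℝ => (1 : ℝ) := by
    have h : Represents x (fun δ => eval x δ 0 s) s := by
      simpa [Represents] using Asymptotics.isBigO_zero _ _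
    exact h.isBigO_one
  have h1 := Asymptotics.IsBigO.mul hf hg.isBigO_one
  have h2 := Asymptotics.IsBigO.mul hs hg
  simp only [mul_one, one_mul] at h1 h2
  refine ((h1.add h2).sub (eval_mul x s t 8 0)).congr_left fun δ => ?_
  simp only [sub_mul, mul_sub]
  abel

theorem bracket (hf : Represents x f s) (hg : Represents x g t) :
    Represents x (fun δ => ⁅f δ, g δ⁆) (s.bracket t) := by
  refine ((hf.mul hg).add ((hg.mul hf).smul (-1))).congr_left fun δ => ?_
  simp [Ring.lie_def, sub_eq_add_neg, WordTree.bracket]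

theorem magnusLegendre {a b c d : ℝ → 𝔸} (ha : Represents x a (legendreTree 1))
    (hb : Represents x b (legendreTree 2)) (hc : Represents x c (legendreTree 3))
    (hd : Represents x d (legendreTree 4)) :
    Represents x (fun δ => (15120 : ℝ) • _root_.magnusLegendre (a δ) (b δ) (c δ) (d δ))
      magnusTree := by
  have hab := ha.bracket hb
  have hac := ha.bracket hc
  have haab := ha.bracket hab
  have haac := ha.bracket hac
  have haaab := ha.bracket haab
  have had := ha.bracket hd
  have h := (ha.smul 15120).add <| (hab.smul (-2520)).add <|
    (haac.smul 252).add <| ((hb.bracket hab).smul (-252)).add <|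
    (haaab.smul 42).add <| ((hb.bracket hc).smul (-504)).add <|
    ((hc.bracket hd).smul (-216)).add <| ((hb.bracket had).smul 108).add <|
    ((hb.bracket (hb.bracket hc)).smul (-72)).add <| ((hc.bracket hac).smul (-36)).add <|
    ((hd.bracket hab).smul (-72)).add <| ((ha.bracket (ha.bracket had)).smul (-18)).add <|
    ((hab.bracket hac).smul (-30)).add <| ((hb.bracket haac).smul 30).add <|
    ((hb.bracket (hb.bracket hab)).smul (-18)).add <| ((hc.bracket haab).smul 6).add <|
    ((ha.bracket (ha.bracket haac)).smul (-6)).add <| ((hab.bracket haab).smul (-2)).add <|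
    ((hb.bracket haaab).smul 6).add <| (ha.bracket (ha.bracket haaab)).smul (-1)
  refine Represents.congr (s := magnusTree) h fun δ => ?_
  simp only [_root_.magnusLegendre]
  push_cast
  module

theorem truncExp (hf : Represents x f s) (m : ℕ) :
    Represents x (fun δ => ∑ k ∈ Finset.range (m + 1),
      ((Nat.descFactorial 8 (m - k) * 15120 ^ (m - k) : ℕ) : ℝ) • f δ ^ (k + 1))
      (s.truncExp m) := by
  induction m with
  | zero => simpa [WordTree.truncExp] using hf
  | succ m ih =>
    refine Represents.congr (s := s.truncExp (m + 1))
      ((hf.smul (Nat.descFactorial 8 (m + 1) * 15120 ^ (m + 1))).add (hf.mul ih)) fun δ => ?_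
    rw [Finset.sum_range_succ' _ (m + 1), Finset.mul_sum]
    simp only [mul_smul_comm, ← pow_succ', Nat.add_sub_add_right, Nat.sub_zero, zero_add, pow_one]
    push_cast
    abel

theorem exp_sub_one [CompleteSpace 𝔸] {θ : ℝ → 𝔸}
    (hf : Represents x (fun δ => (15120 : ℝ) • θ δ) s) :
    Represents x (fun δ => ((8)! * 15120 ^ 8 : ℝ) • (NormedSpace.exp (θ δ) - 1))
      (s.truncExp 7) := by
  have hθ : θ =O[𝓝 0] fun δ : ℝ => δ := by
    have := (hf.isBigO_id.const_smul_left (15120⁻¹ : ℝ))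
    refine this.congr_left fun δ => ?_
    simp
  have hθ0 : Tendsto θ (𝓝 0) (𝓝 0) := hθ.trans_tendsto tendsto_id
  -- Nine terms are the powers `0` to `8`; since `θ = O(δ)`, the remainder `‖θ‖^9` is `O(δ^9)`.
  have h := ((NormedSpace.exp_hasFPowerSeriesAt_zero (𝕂 := ℝ)
    (𝔸 := 𝔸)).isBigO_sub_partialSum_pow 9).comp_tendsto hθ0
  have h9 : (fun δ => ‖θ δ‖ ^ 9) =O[𝓝 0] fun δ : ℝ => δ ^ 9 := hθ.norm_left.pow 9
  refine (((h.trans h9).const_smul_left ((8)! * 15120 ^ 8 : ℝ)).add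
    (hf.truncExp 7)).congr_left fun δ => ?_
  simp only [Function.comp_apply, zero_add, FormalMultilinearSeries.partialSum,
    NormedSpace.expSeries_apply_eq, Finset.sum_range_succ, Finset.sum_range_zero, Pi.smul_apply,
    smul_pow]
  norm_num [Nat.factorial, Nat.descFactorial]
  module

end Represents

end Represents

end WordTree

/-! ### Moments of the Legendre polynomials and expansion of the Legendre coefficients. -/

theorem continuous_legendreP (n : ℕ) : Continuous (legendreP n) := by
  unfold legendreP
  fun_prop

/-- In this range the denominator `(k+1)⋯(k+n)` has only prime factors up to 11, and `2310 =
2·3·5·7·11`. The case check also shows that the natural number division in `legendreWeight` is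
exact. -/
theorem integral_legendreP_mul_pow {n k : ℕ} (hn : 1 ≤ n) (hn4 : n ≤ 4) (hk : k < 8) :
    (2 * (n : ℝ) - 1) * ∫ t in (0 : ℝ)..1, legendreP (n - 1) t * t ^ k =
      WordTree.legendreWeight n k * (2310 ^ (k + 1))⁻¹ := by
  have hi (m : ℕ) (c : ℝ) : IntervalIntegrable (fun t : ℝ => c * t ^ m) MeasureTheory.volume 0 1 :=
    (by fun_prop : Continuous fun t : ℝ => c * t ^ m).intervalIntegrable _ _
  have h (m : ℕ) (c : ℝ) : ∫ t in (0 : ℝ)..1, c * t ^ m = c / (m + 1) := by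
    rw [intervalIntegral.integral_const_mul, integral_pow]
    simp [div_eq_mul_inv]
  interval_cases n
  · have : ∀ t : ℝ, legendreP (1 - 1) t * t ^ k = 1 * t ^ k := fun t => by
      rw [legendreP_zero]
    simp only [this, h]
    interval_cases k <;> norm_num [WordTree.legendreWeight, Nat.ascFactorial, Nat.descFactorial]
  · have : ∀ t : ℝ, legendreP (2 - 1) t * t ^ k = 2 * t ^ (k + 1) + (-1) * t ^ k := fun t => by
      rw [legendreP_one]; ring
    simp only [this]
    rw [intervalIntegral.integral_add (hi _ _) (hi _ _), h, h]
    interval_cases k <;> norm_num [WordTree.legendreWeight, Nat.ascFactorial, Nat.descFactorial]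
  · have : ∀ t : ℝ, legendreP (3 - 1) t * t ^ k =
        6 * t ^ (k + 2) + (-6) * t ^ (k + 1) + 1 * t ^ k := fun t => by
      rw [legendreP_two]; ring
    simp only [this]
    rw [intervalIntegral.integral_add ((hi _ _).add (hi _ _)) (hi _ _),
      intervalIntegral.integral_add (hi _ _) (hi _ _), h, h, h]
    interval_cases k <;> norm_num [WordTree.legendreWeight, Nat.ascFactorial, Nat.descFactorial]
  · have : ∀ t : ℝ, legendreP (4 - 1) t * t ^ k =
        20 * t ^ (k + 3) + (-30) * t ^ (k + 2) + 12 * t ^ (k + 1) + (-1) * t ^ k := fun t => by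
      rw [legendreP_three]; ring
    simp only [this]
    rw [intervalIntegral.integral_add (((hi _ _).add (hi _ _)).add (hi _ _)) (hi _ _),
      intervalIntegral.integral_add ((hi _ _).add (hi _ _)) (hi _ _),
      intervalIntegral.integral_add (hi _ _) (hi _ _), h, h, h, h]
    interval_cases k <;> norm_num [WordTree.legendreWeight, Nat.ascFactorial, Nat.descFactorial]

section Moments

variable {𝔸 : Type*} [NormedRing 𝔸] [NormedAlgebra ℝ 𝔸]

theorem integral_comp_div_smul (w : ℝ → ℝ) (A : ℝ → 𝔸) (δ : ℝ) :
    ∫ t in (0 : ℝ)..δ, w (t / δ) • A t = δ • ∫ u in (0 : ℝ)..1, w u • A (δ * u) := by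
  rcases eq_or_ne δ 0 with rfl | hδ
  · simp
  · have h := intervalIntegral.smul_integral_comp_mul_left (a := 0) (b := 1)
      (fun t => w (t / δ) • A t) δ
    simp only [mul_zero, mul_one] at h
    rw [← h]
    simp [mul_div_cancel_left₀ _ hδ]

/-- Substituting `t = δ u` moves the integral to `[0,1]`: the Taylor terms give the moments of `w`,
and the remainder `O((δ u)^m)` is uniform in `u`. The Jacobian supplies the extra factor `δ`. -/
theorem integral_smul_sub_sum_isBigO [CompleteSpace 𝔸] {A : ℝ → 𝔸} {α : ℕ → 𝔸} {m : ℕ}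
    (hc : ∀ᶠ t in 𝓝 (0 : ℝ), ContinuousAt A t)
    (hA : (fun t => A t - ∑ k ∈ Finset.range m, t ^ k • α k) =O[𝓝 0] fun t : ℝ => t ^ m)
    {w : ℝ → ℝ} (hw : Continuous w) :
    (fun δ => (∫ t in (0 : ℝ)..δ, w (t / δ) • A t) -
      ∑ k ∈ Finset.range m, δ ^ (k + 1) • ((∫ t in (0 : ℝ)..1, w t * t ^ k) • α k))
      =O[𝓝 0] fun δ : ℝ => δ ^ (m + 1) := by
  obtain ⟨C, hC0, hC⟩ := hA.exists_nonneg
  obtain ⟨r, hr, hball⟩ := Metric.eventually_nhds_iff.1 (hc.and hC.bound)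
  obtain ⟨W, hW⟩ := (isCompact_Icc (a := (0 : ℝ)) (b := 1)).exists_bound_of_continuousOn
    hw.continuousOn
  refine Asymptotics.IsBigO.of_bound (W * C) ?_
  filter_upwards [Metric.ball_mem_nhds (0 : ℝ) hr] with δ hδ
  have hδr : |δ| < r := by simpa using hδ
  have hδu {u : ℝ} (hu : u ∈ Set.Icc (0 : ℝ) 1) : |δ * u| ≤ |δ| := by
    rw [abs_mul, abs_of_nonneg hu.1]
    exact mul_le_of_le_one_right (abs_nonneg _) hu.2
  have hball' {u : ℝ} (hu : u ∈ Set.Icc (0 : ℝ) 1) := hball (y := δ * u)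
    (by simpa using (hδu hu).trans_lt hδr)
  have hint : IntervalIntegrable (fun u => w u • A (δ * u)) MeasureTheory.volume 0 1 := by
    refine ContinuousOn.intervalIntegrable fun u hu => ?_
    rw [Set.uIcc_of_le zero_le_one] at hu
    refine (hw.continuousAt.smul ?_).continuousWithinAt
    exact ContinuousAt.comp (f := fun u => δ * u) (hball' hu).1 (by fun_prop)
  have hint2 (k : ℕ) : IntervalIntegrable (fun u => w u • ((δ * u) ^ k • α k))
      MeasureTheory.volume 0 1 :=
    (by fun_prop : Continuous fun u => w u • ((δ * u) ^ k • α k)).intervalIntegrable _ _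
  have key : (∫ t in (0 : ℝ)..δ, w (t / δ) • A t) -
      ∑ k ∈ Finset.range m, δ ^ (k + 1) • ((∫ t in (0 : ℝ)..1, w t * t ^ k) • α k) =
      δ • ∫ u in (0 : ℝ)..1, w u • (A (δ * u) - ∑ k ∈ Finset.range m, (δ * u) ^ k • α k) := by
    simp only [smul_sub, Finset.smul_sum]
    rw [intervalIntegral.integral_sub hint, intervalIntegral.integral_finsetSum fun k _ => hint2 k,
      smul_sub, integral_comp_div_smul, Finset.smul_sum]
    · congr 1
      refine Finset.sum_congr rfl fun k _ => ?_
      rw [← intervalIntegral.integral_smul_const, ← intervalIntegral.integral_smul,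
        ← intervalIntegral.integral_smul]
      congr 1 with u
      module
    · refine Continuous.intervalIntegrable ?_ _ _
      fun_prop
  have hbound : ∀ u ∈ Set.uIoc (0 : ℝ) 1,
      ‖w u • (A (δ * u) - ∑ k ∈ Finset.range m, (δ * u) ^ k • α k)‖ ≤ W * C * |δ| ^ m := by
    intro u hu
    rw [Set.uIoc_of_le zero_le_one] at hu
    have hu' : u ∈ Set.Icc (0 : ℝ) 1 := ⟨hu.1.le, hu.2⟩
    have hW0 : 0 ≤ W := (norm_nonneg _).trans (hW u hu')
    have h2 := (hball' hu').2
    rw [norm_smul, mul_assoc]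
    refine mul_le_mul (hW u hu') ?_ (norm_nonneg _) hW0
    refine h2.trans (mul_le_mul_of_nonneg_left ?_ hC0)
    rw [norm_pow, Real.norm_eq_abs]
    exact pow_le_pow_left₀ (abs_nonneg _) (hδu hu') m
  rw [key, norm_smul, norm_pow, pow_succ', Real.norm_eq_abs]
  have := intervalIntegral.norm_integral_le_of_norm_le_const hbound
  simp only [sub_zero, abs_one, mul_one] at this
  calc _ ≤ |δ| * (W * C * |δ| ^ m) := by gcongr
    _ = _ := by ring

end Moments

/-! ### The polynomial approximate propagator. -/

namespace WordTree

variable {𝔸 : Type*} [NormedRing 𝔸] [NormedAlgebra ℝ 𝔸]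

/-- The Taylor coefficients, scaled so that the Legendre coefficients have integer weights. -/
def scaledLetter (α : ℕ → 𝔸) (k : ℕ) : 𝔸 := ((2310 : ℝ) ^ (k + 1))⁻¹ • α k

theorem represents_legendreCoeff [CompleteSpace 𝔸] {A : ℝ → 𝔸} {α : ℕ → 𝔸}
    (hc : ∀ᶠ t in 𝓝 (0 : ℝ), ContinuousAt A t)
    (hA : (fun t => A t - ∑ k ∈ Finset.range 8, t ^ k • α k) =O[𝓝 0] fun t : ℝ => t ^ 8)
    {n : ℕ} (hn : 1 ≤ n) (hn4 : n ≤ 4) :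
    Represents (scaledLetter α) (fun δ => legendreCoeff A δ n) (legendreTree n) := by
  refine ((integral_smul_sub_sum_isBigO hc hA (continuous_legendreP (n - 1))).const_smul_left
    (2 * (n : ℝ) - 1)).congr_left fun δ => ?_
  simp only [legendreTree, eval_letters, Pi.smul_apply, smul_sub, legendreCoeff]
  congr 1
  rw [Finset.smul_sum]
  refine Finset.sum_congr rfl fun k hk => ?_
  have h := integral_legendreP_mul_pow hn hn4 (Finset.mem_range.1 hk)
  rw [scaledLetter, zero_add, smul_smul (Int.cast _), Int.cast_natCast, ← h, mul_smul,
    smul_comm (2 * (n : ℝ) - 1)]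

theorem represents_generator {A : ℝ → 𝔸} {α : ℕ → 𝔸}
    (hA : (fun t => A t - ∑ k ∈ Finset.range 8, t ^ k • α k) =O[𝓝 0] fun t : ℝ => t ^ 8) :
    Represents (scaledLetter α) (fun δ => δ • A δ) generatorTree := by
  refine ((Asymptotics.isBigO_refl (fun δ : ℝ => δ) _).smul hA).congr (fun δ => ?_) fun δ => ?_
  · rw [generatorTree, eval_letters, smul_sub, Finset.smul_sum]
    congr 1
    refine Finset.sum_congr rfl fun k _ => ?_
    rw [scaledLetter, zero_add, smul_smul (Int.cast _), smul_smul]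
    push_cast
    rw [mul_inv_cancel₀ (by positivity), one_smul, pow_succ']
  · exact (pow_succ' δ 8).symm

theorem represents_self (x : ℕ → 𝔸) (t : WordTree) : Represents x (fun δ => eval x δ 0 t) t := by
  simpa [Represents] using Asymptotics.isBigO_zero _ _

/-- The eighth order expansion of `exp Θ`, for `Θ` the truncated Magnus expansion. -/
def propagatorJet (x : ℕ → 𝔸) (δ : ℝ) : 𝔸 :=
  1 + (((8)! * 15120 ^ 8 : ℝ))⁻¹ • eval x δ 0 (truncExp magnusTree 7)

theorem contDiff_propagatorJet (x : ℕ → 𝔸) : ContDiff ℝ 1 (propagatorJet x) :=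
  contDiff_const.add ((contDiff_eval x _ 0).const_smul _)

/-- The derivative side of the tree identity is exact, so the only errors are the Taylor remainder
of `A` and the truncation of the product. The factor `δ` makes both sides polynomials without
constant term. -/
theorem smul_deriv_propagatorJet {A : ℝ → 𝔸} {α : ℕ → 𝔸}
    (hA : (fun t => A t - ∑ k ∈ Finset.range 8, t ^ k • α k) =O[𝓝 0] fun t : ℝ => t ^ 8) :
    (fun δ : ℝ => δ • (deriv (propagatorJet (scaledLetter α)) δ -
      A δ * propagatorJet (scaledLetter α) δ)) =O[𝓝 0] fun δ : ℝ => δ ^ 9 := by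
  set x := scaledLetter α
  set N : ℝ := (8)! * 15120 ^ 8 with hN
  have hgen := represents_generator hA
  have h := ((hgen.smul (Nat.descFactorial 8 8 * 15120 ^ 8)).add
    (hgen.mul (represents_self x (truncExp magnusTree 7))))
  have hN' : (((Nat.descFactorial 8 8 : ℤ) * 15120 ^ 8 : ℤ) : ℝ) = N := by
    rw [hN, Nat.descFactorial_self]; norm_num
  refine (Asymptotics.IsBigO.const_smul_left h (-N⁻¹)).congr_left fun δ => ?_
  have hz := eval_of_isZero x δ _ euler_truncExp_magnusTree 0
  rw [eval_add, eval_smul, ← smul_deriv_eval] at hz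
  have hd : deriv (propagatorJet x) δ =
      N⁻¹ • deriv (fun δ : ℝ => eval x δ 0 (truncExp magnusTree 7)) δ := by
    unfold propagatorJet
    rw [deriv_const_add, deriv_fun_const_smul]
    exact (contDiff_eval x _ 0).differentiable one_ne_zero δ
  simp only [Pi.smul_apply, hN']
  rw [Int.cast_neg, Int.cast_one, neg_one_smul, ← sub_eq_add_neg, sub_eq_zero] at hz
  have hs (a b : 𝔸) : δ • (N⁻¹ • a - b) = N⁻¹ • (δ • a) - δ • b := by module
  rw [hd, hs, hz, propagatorJet, ← hN]
  simp only [mul_add, mul_one, mul_smul_comm, smul_mul_assoc, smul_add, smul_sub, smul_smul,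
    neg_mul]
  module

end WordTree

/-! ### The derivative of the exponential. -/

section AdPow

variable {R : Type*} [Ring R]

/-- The iterated commutator `[X,[X,…,[X,Y]…]]`. -/
def adPow (X : R) (m : ℕ) (Y : R) : R := (fun Z => ⁅X, Z⁆)^[m] Y

theorem adPow_zero (X Y : R) : adPow X 0 Y = Y := rfl

theorem adPow_succ (X Y : R) (m : ℕ) : adPow X (m + 1) Y = ⁅X, adPow X m Y⁆ :=
  Function.iterate_succ_apply' _ _ _

theorem mul_adPow (X Y : R) (m : ℕ) : X * adPow X m Y = adPow X (m + 1) Y + adPow X m Y * X := by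
  rw [adPow_succ, Ring.lie_def, sub_add_cancel]

/-- Left multiplication by `X` is the sum of `ad_X` and right multiplication by `X`, which commute;
this is the binomial theorem for them. -/
theorem pow_mul_eq_sum_adPow (X Y : R) (n : ℕ) :
    X ^ n * Y = ∑ p ∈ Finset.HasAntidiagonal.antidiagonal n,
        n.choose p.1 • (adPow X p.1 Y * X ^ p.2) := by
  induction n with
  | zero => simp [adPow_zero]
  | succ n ih =>
    rw [Finset.sum_antidiagonal_choose_succ_nsmul (fun i j => adPow X i Y * X ^ j) n, pow_succ',
      mul_assoc, ih, Finset.mul_sum, ← Finset.sum_add_distrib]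
    refine Finset.sum_congr rfl fun p hp => ?_
    rw [Finset.HasAntidiagonal.mem_antidiagonal] at hp
    rw [← Nat.choose_symm_of_eq_add hp.symm, mul_smul_comm, ← mul_assoc, mul_adPow, add_mul,
      smul_add, mul_assoc, ← pow_succ', add_comm]

/-- With `L = ad_X + R` for left and right multiplication, this is the expansion of `(L^(n+1) -
R^(n+1)) / ad_X`, proved by Pascal's rule. -/
theorem sum_pow_mul_mul_pow (X Y : R) (n : ℕ) :
    ∑ i ∈ Finset.range (n + 1), X ^ (n - i) * Y * X ^ i =
      ∑ p ∈ Finset.HasAntidiagonal.antidiagonal n,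
        (n + 1).choose (p.1 + 1) • (adPow X p.1 Y * X ^ p.2) := by
  induction n with
  | zero => simp [adPow_zero]
  | succ n ih =>
    simp only [Nat.choose_succ_succ (n + 1), add_smul, Finset.sum_add_distrib]
    rw [← pow_mul_eq_sum_adPow, Finset.Nat.sum_antidiagonal_succ', Finset.sum_range_succ']
    have h (i : ℕ) : X ^ (n + 1 - (i + 1)) * Y * X ^ (i + 1) = X ^ (n - i) * Y * X ^ i * X := by
      rw [Nat.add_sub_add_right, pow_succ, ← mul_assoc]
    simp only [h, ← Finset.sum_mul, ih]
    simp only [Nat.choose_succ_self, zero_smul, zero_add, Nat.sub_zero, pow_zero, mul_one,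
      Finset.sum_mul, smul_mul_assoc, mul_assoc, ← pow_succ]
    rw [add_comm]

end AdPow

section DExp

variable {𝔸 : Type*} [NormedRing 𝔸]

/-- Keeping the factor `Y` makes the bound valid at `n = 0`, since `‖1‖ ≤ 1` is not assumed. -/
theorem norm_pow_mul_le (X Y : 𝔸) (n : ℕ) : ‖X ^ n * Y‖ ≤ ‖X‖ ^ n * ‖Y‖ := by
  induction n with
  | zero => simp
  | succ n ih =>
    rw [pow_succ', mul_assoc, pow_succ', mul_assoc]
    exact (norm_mul_le _ _).trans (by gcongr)

theorem norm_mul_pow_le (X Y : 𝔸) (n : ℕ) : ‖Y * X ^ n‖ ≤ ‖Y‖ * ‖X‖ ^ n := by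
  induction n with
  | zero => simp
  | succ n ih =>
    rw [pow_succ, ← mul_assoc, pow_succ, ← mul_assoc]
    exact (norm_mul_le _ _).trans (by gcongr)

theorem norm_lie_le_two_mul (X Y : 𝔸) : ‖⁅X, Y⁆‖ ≤ 2 * ‖X‖ * ‖Y‖ := by
  rw [Ring.lie_def]
  calc _ ≤ ‖X * Y‖ + ‖Y * X‖ := norm_sub_le _ _
    _ ≤ ‖X‖ * ‖Y‖ + ‖Y‖ * ‖X‖ := add_le_add (norm_mul_le _ _) (norm_mul_le _ _)
    _ = _ := by ring

theorem norm_adPow_le (X Y : 𝔸) (m : ℕ) : ‖adPow X m Y‖ ≤ (2 * ‖X‖) ^ m * ‖Y‖ := by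
  induction m with
  | zero => simp [adPow_zero]
  | succ m ih =>
    rw [adPow_succ, pow_succ', mul_assoc]
    exact (norm_lie_le_two_mul _ _).trans (by gcongr)

theorem norm_sum_pow_mul_mul_pow_le (X Y : 𝔸) (n : ℕ) :
    ‖∑ i ∈ Finset.range (n + 1), X ^ (n - i) * Y * X ^ i‖ ≤ (n + 1) * (‖X‖ ^ n * ‖Y‖) := by
  have h : ∀ i ∈ Finset.range (n + 1), ‖X ^ (n - i) * Y * X ^ i‖ ≤ ‖X‖ ^ n * ‖Y‖ := by
    intro i hi
    have hi' : i ≤ n := Nat.lt_succ_iff.1 (Finset.mem_range.1 hi)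
    calc _ ≤ ‖X ^ (n - i) * Y‖ * ‖X‖ ^ i := norm_mul_pow_le _ _ _
      _ ≤ ‖X‖ ^ (n - i) * ‖Y‖ * ‖X‖ ^ i := by gcongr; exact norm_pow_mul_le _ _ _
      _ = ‖X‖ ^ (n - i) * ‖X‖ ^ i * ‖Y‖ := by ring
      _ = _ := by rw [← pow_add, Nat.sub_add_cancel hi']
  refine (norm_sum_le_of_le _ h).trans ?_
  simp

variable [NormedAlgebra ℝ 𝔸]

/-- The right logarithmic derivative of the exponential at `X` in the direction `Y`. -/
def dexp (X Y : 𝔸) : 𝔸 := ∑' m : ℕ, (((m + 1)! : ℝ)⁻¹) • adPow X m Y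

theorem summable_norm_dexp (X Y : 𝔸) :
    Summable fun m : ℕ => ‖(((m + 1)! : ℝ)⁻¹) • adPow X m Y‖ := by
  refine Summable.of_nonneg_of_le (fun _ => norm_nonneg _) (fun m => ?_)
    ((Real.summable_pow_div_factorial (2 * ‖X‖)).mul_right ‖Y‖)
  rw [norm_smul, norm_inv, Real.norm_natCast, div_mul_eq_mul_div, inv_mul_eq_div]
  have : (m ! : ℝ) ≤ (m + 1)! := by exact_mod_cast Nat.factorial_le (Nat.le_succ m)
  gcongr
  exact norm_adPow_le X Y m

/-- After `sum_pow_mul_mul_pow`, the quotient `(i+j+1).choose (i+1) / (i+j+1)!` equals `1 / ((i+1)!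
j!)`, so the left side is the Cauchy product of the two series on the right. -/
theorem tsum_inv_factorial_smul_sum_pow [CompleteSpace 𝔸] (X Y : 𝔸) :
    ∑' n : ℕ, (((n + 1)! : ℝ)⁻¹) • ∑ i ∈ Finset.range (n + 1), X ^ (n - i) * Y * X ^ i =
      dexp X Y * NormedSpace.exp X := by
  rw [NormedSpace.exp_eq_tsum ℝ, dexp, tsum_mul_tsum_eq_tsum_sum_antidiagonal_of_summable_norm
    (summable_norm_dexp X Y) (NormedSpace.norm_expSeries_summable' X)]
  refine tsum_congr fun n => ?_
  rw [sum_pow_mul_mul_pow, Finset.smul_sum]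
  refine Finset.sum_congr rfl fun p hp => ?_
  obtain ⟨i, j⟩ := p
  obtain rfl : i + j = n := Finset.HasAntidiagonal.mem_antidiagonal.1 hp
  rw [smul_mul_smul_comm, ← Nat.cast_smul_eq_nsmul ℝ, smul_smul]
  congr 1
  have h := Nat.choose_mul_factorial_mul_factorial (show i + 1 ≤ i + j + 1 by omega)
  rw [show i + j + 1 - (i + 1) = j by omega] at h
  have h' : ((i + j + 1).choose (i + 1) : ℝ) * (i + 1)! * j ! = (i + j + 1)! := by exact_mod_cast h
  have h1 : ((i + 1)! : ℝ) ≠ 0 := by positivity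
  have h2 : (j ! : ℝ) ≠ 0 := by positivity
  have h3 : ((i + j + 1)! : ℝ) ≠ 0 := by positivity
  rw [← mul_inv, inv_mul_eq_div, div_eq_iff h3, ← h']
  field_simp

theorem hasDerivAt_exp_add_smul [CompleteSpace 𝔸] (X Y : 𝔸) :
    HasDerivAt (fun s : ℝ => NormedSpace.exp (X + s • Y)) (dexp X Y * NormedSpace.exp X) 0 := by
  set g : ℕ → ℝ → 𝔸 := fun n s => ((n ! : ℝ)⁻¹) • (X + s • Y) ^ n
  set g' : ℕ → ℝ → 𝔸 := fun n s => ((n ! : ℝ)⁻¹) •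
    ∑ i ∈ Finset.range n, (X + s • Y) ^ (n.pred - i) * Y * (X + s • Y) ^ i
  set r : ℝ := ‖X‖ + ‖Y‖
  set u : ℕ → ℝ := fun n => (n ! : ℝ)⁻¹ * (n * (r ^ (n - 1) * ‖Y‖))
  have hu : Summable u := by
    rw [← summable_nat_add_iff 1]
    refine ((Real.summable_pow_div_factorial r).mul_right ‖Y‖).congr fun n => ?_
    simp only [u, Nat.add_sub_cancel, Nat.factorial_succ]
    push_cast
    have : (n ! : ℝ) ≠ 0 := by positivity
    field_simp
  have hg : ∀ n s, s ∈ Metric.ball (0 : ℝ) 1 → HasDerivAt (g n) (g' n s) s := by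
    intro n s _
    have h : HasDerivAt (fun s : ℝ => X + s • Y) Y s := by
      simpa using ((hasDerivAt_id s).smul_const Y).const_add X
    exact (h.fun_pow' n).fun_const_smul ((n ! : ℝ)⁻¹)
  have hg' : ∀ n s, s ∈ Metric.ball (0 : ℝ) 1 → ‖g' n s‖ ≤ u n := by
    intro n s hs
    simp only [g', u, norm_smul, norm_inv, Real.norm_natCast]
    refine mul_le_mul_of_nonneg_left ?_ (by positivity)
    cases n with
    | zero => simp
    | succ n =>
      have hs1 : ‖s‖ ≤ 1 := by simpa using (Metric.mem_ball.1 hs).le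
      have hX : ‖X + s • Y‖ ≤ r := (norm_add_le _ _).trans <| by
        rw [norm_smul]
        exact add_le_add_right (mul_le_of_le_one_left (norm_nonneg _) hs1) _
      refine (norm_sum_pow_mul_mul_pow_le _ _ n).trans ?_
      push_cast
      gcongr
  have h := hasDerivAt_tsum_of_isPreconnected hu Metric.isOpen_ball
    (convex_ball (0 : ℝ) 1).isPreconnected hg hg' (Metric.mem_ball_self one_pos)
    (NormedSpace.expSeries_summable' (𝕂 := ℝ) (X + (0 : ℝ) • Y)) (Metric.mem_ball_self one_pos)
  have hsum : ∑' n, g' n 0 = dexp X Y * NormedSpace.exp X := by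
    have hs : Summable fun n => g' n 0 := .of_norm_bounded hu fun n =>
      hg' n 0 (Metric.mem_ball_self one_pos)
    rw [hs.tsum_eq_zero_add, ← tsum_inv_factorial_smul_sum_pow]
    simp [g']
  rw [hsum] at h
  simpa only [NormedSpace.exp_eq_tsum ℝ] using h

/-- Analyticity gives a Fréchet derivative of `exp` at `f t`; its value on `f'` is identified by the
derivative along the line through `f t`. -/
theorem HasDerivAt.normedSpace_exp [CompleteSpace 𝔸] {f : ℝ → 𝔸} {f' : 𝔸} {t : ℝ}
    (hf : HasDerivAt f f' t) :
    HasDerivAt (fun s => NormedSpace.exp (f s)) (dexp (f t) f' * NormedSpace.exp (f t)) t := by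
  obtain ⟨E, hE⟩ := (NormedSpace.exp_analytic (𝕂 := ℝ) (f t)).differentiableAt
  have h1 := hE.comp_hasDerivAt t hf
  have hl : HasDerivAt (fun s : ℝ => f t + s • f') f' 0 := by
    simpa using ((hasDerivAt_id (0 : ℝ)).smul_const f').const_add (f t)
  have hE' : HasFDerivAt NormedSpace.exp E (f t + (0 : ℝ) • f') := by simpa using hE
  have h2 := hE'.comp_hasDerivAt (0 : ℝ) hl
  rw [← h2.unique (hasDerivAt_exp_add_smul (f t) f')]
  exact h1

end DExp

/-! ### Graded nested commutators and the Magnus recursion. -/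

section NestedComm

variable {R : Type*} [Ring R]

theorem nestedComm_zero (x : Fin 0 → R) (y : R) : nestedComm x y = y := by
  simp [nestedComm]

theorem nestedComm_succ {m : ℕ} (x : Fin (m + 1) → R) (y : R) :
    nestedComm x y = ⁅x 0, nestedComm (fun i => x i.succ) y⁆ := by
  simp [nestedComm, List.ofFn_succ]

/-- The degree `n` part of `[w,[w,…,[w,d]…]]` (`m` brackets) for series with terms `w k`, `d k`. -/
def lieConv (w d : ℕ → R) : ℕ → ℕ → R
  | 0, n => d n
  | m + 1, n => ∑ p ∈ Finset.HasAntidiagonal.antidiagonal n, ⁅w p.1, lieConv w d m p.2⁆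

theorem sum_antidiagonalTuple_succ {M : Type*} [AddCommMonoid M] (m n : ℕ)
    (f : (Fin (m + 1) → ℕ) → M) :
    ∑ v ∈ Finset.Nat.antidiagonalTuple (m + 1) n, f v =
      ∑ p ∈ Finset.HasAntidiagonal.antidiagonal n,
        ∑ v ∈ Finset.Nat.antidiagonalTuple m p.2, f (Fin.cons p.1 v) := by
  rw [Finset.sum_sigma']
  refine (Finset.sum_nbij' (fun q => Fin.cons q.1.1 q.2)
    (fun v => ⟨(v 0, n - v 0), Fin.tail v⟩) ?_ ?_ ?_ ?_ ?_).symm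
  · rintro ⟨⟨a, b⟩, v⟩ h
    simp only [Finset.mem_sigma, Finset.HasAntidiagonal.mem_antidiagonal,
      Finset.Nat.mem_antidiagonalTuple] at h ⊢
    rw [Fin.sum_cons, h.2, h.1]
  · intro v h
    simp only [Finset.mem_sigma, Finset.HasAntidiagonal.mem_antidiagonal,
      Finset.Nat.mem_antidiagonalTuple, Fin.sum_univ_succ, Fin.tail] at h ⊢
    omega
  · rintro ⟨⟨a, b⟩, v⟩ h
    simp only [Finset.mem_sigma, Finset.HasAntidiagonal.mem_antidiagonal] at h
    simp only [Fin.cons_zero, Fin.tail_cons, ← h.1, Nat.add_sub_cancel_left]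
  · intro v _
    simp
  · intro _ _
    rfl

theorem lieConv_eq_sum_antidiagonalTuple (w d : ℕ → R) (m n : ℕ) :
    lieConv w d m n = ∑ v ∈ Finset.Nat.antidiagonalTuple (m + 1) n,
      nestedComm (fun i : Fin m => w (v i.castSucc)) (d (v (Fin.last m))) := by
  induction m generalizing n with
  | zero => simp [lieConv, nestedComm_zero]
  | succ m ih =>
    rw [sum_antidiagonalTuple_succ, lieConv]
    refine Finset.sum_congr rfl fun p _ => ?_
    rw [ih, Ring.lie_def, Finset.mul_sum, Finset.sum_mul, ← Finset.sum_sub_distrib]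
    refine Finset.sum_congr rfl fun v _ => ?_
    rw [nestedComm_succ]
    rfl

theorem nestedComm_eq_zero {m : ℕ} (x : Fin m → R) (y : R) (h : y = 0 ∨ ∃ i, x i = 0) :
    nestedComm x y = 0 := by
  induction m with
  | zero => simpa [nestedComm_zero] using h
  | succ m ih =>
    rw [nestedComm_succ]
    rcases h with h | ⟨i, hi⟩
    · simp [ih _ (.inl h), Ring.lie_def]
    · cases i using Fin.cases with
      | zero => simp [hi, Ring.lie_def]
      | succ i => simp [ih (fun i => x i.succ) (.inr ⟨i, hi⟩), Ring.lie_def]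

/-- Since the index `0` terms vanish, tuples with a zero entry contribute nothing. The recursion can
thus be read as a convolution over all of `ℕ`. -/
theorem lieConv_eq_sum_positiveTuples {w d : ℕ → R} (hw : w 0 = 0) (hd : d 0 = 0) (m n : ℕ) :
    lieConv w d m n = ∑ v ∈ positiveTuples m n,
      nestedComm (fun i : Fin m => w (v i.castSucc)) (d (v (Fin.last m))) := by
  rw [lieConv_eq_sum_antidiagonalTuple, positiveTuples]
  refine (Finset.sum_filter_of_ne fun v _ hv => ?_).symm
  contrapose! hv
  obtain ⟨i, hi⟩ := hv
  have hi0 : v i = 0 := by omega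
  refine nestedComm_eq_zero _ _ ?_
  cases i using Fin.lastCases with
  | last => exact .inl (by rw [hi0, hd])
  | cast i => exact .inr ⟨i, by rw [hi0, hw]⟩

theorem lieConv_eq_zero {w d : ℕ → R} (hw : w 0 = 0) (hd : d 0 = 0) {m n : ℕ} (h : n ≤ m) :
    lieConv w d m n = 0 := by
  induction m generalizing n with
  | zero => rw [Nat.le_zero.1 h, lieConv, hd]
  | succ m ih =>
    rw [lieConv]
    refine Finset.sum_eq_zero fun p hp => ?_
    rw [Finset.HasAntidiagonal.mem_antidiagonal] at hp
    rcases Nat.eq_zero_or_pos p.1 with h0 | h0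
    · simp [h0, hw, Ring.lie_def]
    · simp [ih (show p.2 ≤ m by omega), Ring.lie_def]

end NestedComm

section LieSeries

variable {𝔸 : Type*} [NormedRing 𝔸]

theorem norm_nestedComm_le {m : ℕ} (x : Fin m → 𝔸) (y : 𝔸) :
    ‖nestedComm x y‖ ≤ 2 ^ m * ((∏ i, ‖x i‖) * ‖y‖) := by
  induction m with
  | zero => simp [nestedComm_zero]
  | succ m ih =>
    rw [nestedComm_succ, Fin.prod_univ_succ]
    calc _ ≤ 2 * ‖x 0‖ * (2 ^ m * ((∏ i : Fin m, ‖x i.succ‖) * ‖y‖)) :=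
          (norm_lie_le_two_mul _ _).trans (by gcongr; exact ih _)
      _ = _ := by ring

theorem continuousOn_nestedComm {X : Type*} [TopologicalSpace X] {s : Set X} {m : ℕ}
    {f : Fin m → X → 𝔸} {g : X → 𝔸} (hf : ∀ i, ContinuousOn (f i) s) (hg : ContinuousOn g s) :
    ContinuousOn (fun t => nestedComm (fun i => f i t) (g t)) s := by
  induction m with
  | zero => simpa only [nestedComm_zero] using hg
  | succ m ih =>
    simp only [nestedComm_succ, Ring.lie_def]
    have h := ih fun i => hf i.succ
    exact ((hf 0).mul h).sub (h.mul (hf 0))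

variable [CompleteSpace 𝔸] {w d : ℕ → 𝔸}

/-- Each bracket is a difference of two Cauchy products. The norm bound, with `m`th power growth, is
what makes the double series in `dexp_tsum_eq` absolutely summable. -/
theorem summable_norm_lieConv_and_tsum_eq (hw : Summable fun n => ‖w n‖)
    (hd : Summable fun n => ‖d n‖) (m : ℕ) :
    (Summable fun n => ‖lieConv w d m n‖) ∧
      (∑' n, lieConv w d m n = adPow (∑' n, w n) m (∑' n, d n)) ∧
      ∑' n, ‖lieConv w d m n‖ ≤ (2 * ∑' n, ‖w n‖) ^ m * ∑' n, ‖d n‖ := by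
  induction m with
  | zero => simpa [lieConv, adPow_zero] using hd
  | succ m ih =>
    obtain ⟨h1, h2, h3⟩ := ih
    have ha := summable_norm_sum_mul_antidiagonal_of_summable_norm hw h1
    have hb := summable_norm_sum_mul_antidiagonal_of_summable_norm h1 hw
    have hb' (n : ℕ) : ∑ p ∈ Finset.HasAntidiagonal.antidiagonal n, lieConv w d m p.1 * w p.2 =
        ∑ p ∈ Finset.HasAntidiagonal.antidiagonal n, lieConv w d m p.2 * w p.1 :=
      Finset.Nat.sum_antidiagonal_swap
        (f := fun p : ℕ × ℕ => lieConv w d m p.2 * w p.1)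
    have hlie (n : ℕ) : lieConv w d (m + 1) n =
        ∑ p ∈ Finset.HasAntidiagonal.antidiagonal n, w p.1 * lieConv w d m p.2 -
        ∑ p ∈ Finset.HasAntidiagonal.antidiagonal n, lieConv w d m p.1 * w p.2 := by
      rw [hb', ← Finset.sum_sub_distrib]
      rfl
    have hprod := (summable_norm_sum_mul_antidiagonal_of_summable_norm (f := fun n => ‖w n‖)
      (g := fun n => ‖lieConv w d m n‖) (by simpa using hw) (by simpa using h1)).of_norm
    have hle (n : ℕ) : ‖lieConv w d (m + 1) n‖ ≤
        2 * ∑ p ∈ Finset.HasAntidiagonal.antidiagonal n, ‖w p.1‖ * ‖lieConv w d m p.2‖ := by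
      rw [lieConv, Finset.mul_sum]
      refine norm_sum_le_of_le _ fun p _ => ?_
      rw [← mul_assoc]
      exact norm_lie_le_two_mul _ _
    have hsum : Summable fun n => ‖lieConv w d (m + 1) n‖ :=
      .of_nonneg_of_le (fun _ => norm_nonneg _) hle (hprod.mul_left 2)
    refine ⟨hsum, ?_, ?_⟩
    · simp only [hlie]
      rw [ha.of_norm.tsum_sub hb.of_norm, adPow_succ, Ring.lie_def, ← h2,
        tsum_mul_tsum_eq_tsum_sum_antidiagonal_of_summable_norm hw h1,
        tsum_mul_tsum_eq_tsum_sum_antidiagonal_of_summable_norm h1 hw]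
    · refine (hsum.tsum_le_tsum hle (hprod.mul_left 2)).trans ?_
      rw [tsum_mul_left, ← tsum_mul_tsum_eq_tsum_sum_antidiagonal_of_summable_norm
        (f := fun n => ‖w n‖) (g := fun n => ‖lieConv w d m n‖) (by simpa using hw)
        (by simpa using h1), pow_succ', mul_assoc, ← mul_assoc]
      gcongr

variable [NormedAlgebra ℝ 𝔸]

/-- Expanding `dexp` into its graded parts and exchanging the sums over `m` and `n`, the recursion
cancels every degree except `1`, where `a` remains. -/
theorem dexp_tsum_eq {a : 𝔸} (hw : Summable fun n => ‖w n‖) (hd : Summable fun n => ‖d n‖)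
    (hw0 : w 0 = 0) (hd0 : d 0 = 0) (hd1 : d 1 = a)
    (hrec : ∀ n, 2 ≤ n →
      d n = -∑ m ∈ Finset.Icc 1 (n - 1), (1 / ((m + 1)! : ℝ)) • lieConv w d m n) :
    dexp (∑' n, w n) (∑' n, d n) = a := by
  set f : ℕ → ℕ → 𝔸 := fun m n => ((m + 1)! : ℝ)⁻¹ • lieConv w d m n
  have hf1 (m : ℕ) : Summable fun n => ‖f m n‖ := by
    simp only [f, norm_smul]
    exact (summable_norm_lieConv_and_tsum_eq hw hd m).1.mul_left _
  have hf : Summable (Function.uncurry f) := by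
    refine Summable.of_norm ((summable_prod_of_nonneg fun _ => norm_nonneg _).2 ⟨hf1, ?_⟩)
    refine .of_nonneg_of_le (fun _ => tsum_nonneg fun _ => norm_nonneg _) (fun m => ?_)
      ((Real.summable_pow_div_factorial (2 * ∑' n, ‖w n‖)).mul_right (∑' n, ‖d n‖))
    simp only [Function.uncurry, f, norm_smul, norm_inv, Real.norm_natCast, tsum_mul_left]
    rw [div_mul_eq_mul_div, inv_mul_eq_div]
    have : (m ! : ℝ) ≤ (m + 1)! := by exact_mod_cast Nat.factorial_le (Nat.le_succ m)
    have h0 : 0 ≤ ∑' n, ‖w n‖ := tsum_nonneg fun _ => norm_nonneg _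
    have h1 : 0 ≤ ∑' n, ‖d n‖ := tsum_nonneg fun _ => norm_nonneg _
    gcongr
    exact (summable_norm_lieConv_and_tsum_eq hw hd m).2.2
  have hn (n : ℕ) : ∑' m, f m n = if n = 1 then a else 0 := by
    -- With `m` brackets the least degree is `m + 1`, so the sum over `m` is finite in each degree.
    have hz : ∀ m ∉ Finset.range n, f m n = 0 := fun m hm => by
      simp only [f]
      rw [lieConv_eq_zero hw0 hd0 (by simpa using hm), smul_zero]
    rw [tsum_eq_sum hz]
    match n with
    | 0 => simp
    | 1 => simp [f, lieConv, hd1]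
    | n + 2 =>
      rw [if_neg (by omega), Finset.sum_range_succ', add_comm]
      have h := hrec (n + 2) (by omega)
      rw [show n + 2 - 1 = n + 1 by omega, ← Finset.Ico_succ_right_eq_Icc] at h
      simp only [Finset.sum_Ico_eq_sum_range] at h
      simp only [f]
      rw [zero_add, Nat.factorial_one, Nat.cast_one, inv_one, one_smul, lieConv, h]
      simp [add_comm 1]
  have hm (m : ℕ) : (((m + 1)! : ℝ)⁻¹) • adPow (∑' n, w n) m (∑' n, d n) = ∑' n, f m n := by
    rw [← (summable_norm_lieConv_and_tsum_eq hw hd m).2.1,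
      ← (summable_norm_lieConv_and_tsum_eq hw hd m).1.of_norm.tsum_const_smul]
  rw [dexp, tsum_congr hm, ← Summable.tsum_comm hf, tsum_congr hn, tsum_ite_eq]

end LieSeries

/-! ### Majorant and convergence of the Magnus series. -/

theorem sum_of_mem_positiveTuples {m n : ℕ} {v : Fin (m + 1) → ℕ} (hv : v ∈ positiveTuples m n) :
    ∑ i, v i = n :=
  Finset.Nat.mem_antidiagonalTuple.1 (Finset.mem_filter.1 hv).1

/-- Expand the power on the right: a tuple determines `n` as its sum, so nothing is counted twice,
and `m ≥ 1` forces all entries to be at most `N`. -/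
theorem sum_positiveTuples_prod_le {β : ℕ → ℝ} (hβ : ∀ n, 0 ≤ β n) {m N : ℕ} (hm : 1 ≤ m) :
    ∑ n ∈ Finset.Icc 2 (N + 1), ∑ v ∈ positiveTuples m n, ∏ i, β (v i) ≤
      (∑ n ∈ Finset.Icc 1 N, β n) ^ (m + 1) := by
  have hpow : (∑ n ∈ Finset.Icc 1 N, β n) ^ (m + 1) =
      ∑ v ∈ Fintype.piFinset fun _ : Fin (m + 1) => Finset.Icc 1 N, ∏ i, β (v i) := by
    rw [← Finset.prod_univ_sum (fun _ : Fin (m + 1) => Finset.Icc 1 N) fun _ => β]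
    simp
  rw [hpow, ← Finset.sum_biUnion]
  · refine Finset.sum_le_sum_of_subset_of_nonneg ?_ fun v _ _ => Finset.prod_nonneg fun i _ => hβ _
    intro v hv
    obtain ⟨n, hn, hv⟩ := Finset.mem_biUnion.1 hv
    rw [Finset.mem_Icc] at hn
    refine Fintype.mem_piFinset.2 fun i => Finset.mem_Icc.2
      ⟨(Finset.mem_filter.1 hv).2 i, ?_⟩
    have := lt_of_mem_positiveTuples hm hv i
    omega
  · intro n _ n' _ hne
    refine Finset.disjoint_left.2 fun v hv hv' => hne ?_
    rw [← sum_of_mem_positiveTuples hv, sum_of_mem_positiveTuples hv']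

/-- The bound `1/4` reproduces itself: using `(m+1)! ≥ 2`, the next partial sum is at most `1/8 +
∑_{m≥1} (1/2) 2^m (1/4)^(m+1) ≤ 1/8 + 1/8`. -/
theorem sum_Icc_le_of_magnus_recursion {β : ℕ → ℝ} (hβ : ∀ n, 0 ≤ β n) (h1 : β 1 ≤ 1 / 8)
    (hrec : ∀ n, 2 ≤ n → β n ≤ ∑ m ∈ Finset.Icc 1 (n - 1), (1 / ((m + 1)! : ℝ)) *
      ∑ v ∈ positiveTuples m n, 2 ^ m * ∏ i, β (v i)) (N : ℕ) :
    ∑ n ∈ Finset.Icc 1 N, β n ≤ 1 / 4 := by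
  induction N with
  | zero => simp
  | succ N ih =>
    set S := ∑ n ∈ Finset.Icc 1 N, β n with hS
    have hS0 : 0 ≤ S := Finset.sum_nonneg fun _ _ => hβ _
    have hterm (m n : ℕ) : 0 ≤ (1 / ((m + 1)! : ℝ)) *
        ∑ v ∈ positiveTuples m n, 2 ^ m * ∏ i, β (v i) :=
      mul_nonneg (by positivity) <| Finset.sum_nonneg fun v _ =>
        mul_nonneg (by positivity) (Finset.prod_nonneg fun i _ => hβ _)
    have hsplit : ∑ n ∈ Finset.Icc 1 (N + 1), β n = β 1 + ∑ n ∈ Finset.Icc 2 (N + 1), β n := by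
      rw [← Finset.add_sum_Ioc_eq_sum_Icc (by omega)]
      rfl
    have hle : ∑ n ∈ Finset.Icc 2 (N + 1), β n ≤
        ∑ m ∈ Finset.Icc 1 N, (1 / 8 : ℝ) * (1 / 2) ^ m := by
      calc ∑ n ∈ Finset.Icc 2 (N + 1), β n
          ≤ ∑ n ∈ Finset.Icc 2 (N + 1), ∑ m ∈ Finset.Icc 1 N, (1 / ((m + 1)! : ℝ)) *
              ∑ v ∈ positiveTuples m n, 2 ^ m * ∏ i, β (v i) := by
            refine Finset.sum_le_sum fun n hn => ?_
            rw [Finset.mem_Icc] at hn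
            refine (hrec n hn.1).trans ?_
            refine Finset.sum_le_sum_of_subset_of_nonneg
              (Finset.Icc_subset_Icc_right (by omega)) fun m _ _ => hterm m n
        _ = ∑ m ∈ Finset.Icc 1 N, (1 / ((m + 1)! : ℝ)) * 2 ^ m *
              ∑ n ∈ Finset.Icc 2 (N + 1), ∑ v ∈ positiveTuples m n, ∏ i, β (v i) := by
            rw [Finset.sum_comm]
            simp only [Finset.mul_sum, mul_assoc]
        _ ≤ _ := by
            refine Finset.sum_le_sum fun m hm => ?_
            rw [Finset.mem_Icc] at hm
            have hfac : (2 : ℝ) ≤ (m + 1)! := by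
              exact_mod_cast Nat.factorial_le (show 2 ≤ m + 1 by omega)
            calc _ ≤ (1 / 2) * 2 ^ m * S ^ (m + 1) := by
                  gcongr
                  · exact Finset.sum_nonneg fun n _ => Finset.sum_nonneg fun v _ =>
                      Finset.prod_nonneg fun i _ => hβ _
                  · exact sum_positiveTuples_prod_le hβ hm.1
              _ ≤ (1 / 2) * 2 ^ m * (1 / 4) ^ (m + 1) := by gcongr
              _ = _ := by
                rw [pow_succ, show (1 / 4 : ℝ) = 1 / 2 * (1 / 2) by norm_num, mul_pow]
                have : (2 : ℝ) ^ m * (1 / 2) ^ m = 1 := by rw [← mul_pow]; norm_num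
                linear_combination (1 / 8 : ℝ) * (1 / 2) ^ m * this
    have hgeom : ∑ m ∈ Finset.Icc 1 N, (1 / 8 : ℝ) * (1 / 2) ^ m ≤ 1 / 8 := by
      have : ∑ m ∈ Finset.Icc 1 N, (1 / 8 : ℝ) * (1 / 2) ^ m = 1 / 8 * (1 - (1 / 2) ^ N) := by
        clear * -
        induction N with
        | zero => simp
        | succ N ih =>
          rw [Finset.sum_Icc_succ_top (by omega), ih]
          ring
      rw [this]
      have : (0 : ℝ) ≤ (1 / 2) ^ N := by positivity
      linarith
    linarith

section Magnus

variable {𝔸 : Type*} [NormedRing 𝔸] [NormedAlgebra ℝ 𝔸]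

theorem magnusDot_zero (A : ℝ → 𝔸) : magnusDot A 0 = 0 := by
  rw [magnusDot]
  funext t
  simp [magnusStep]

theorem magnusTerm_index_zero (A : ℝ → 𝔸) (t : ℝ) : magnusTerm A 0 t = 0 := by
  simp [magnusTerm, magnusDot_zero]

theorem magnusSeries_zero (A : ℝ → 𝔸) : magnusSeries A 0 = 0 := by
  simp [magnusSeries, magnusTerm]

theorem uIcc_subset_ball_zero {r t : ℝ} (ht : t ∈ Metric.ball (0 : ℝ) r) :
    Set.uIcc 0 t ⊆ Metric.ball (0 : ℝ) r :=
  (convex_ball (0 : ℝ) r).ordConnected.uIcc_subset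
    (Metric.mem_ball_self (Metric.pos_of_mem_ball ht)) ht

theorem magnusDot_eq_lieConv (A : ℝ → 𝔸) {n : ℕ} (hn : 2 ≤ n) (t : ℝ) :
    magnusDot A n t = -∑ m ∈ Finset.Icc 1 (n - 1), (1 / ((m + 1)! : ℝ)) •
      lieConv (fun k => magnusTerm A k t) (fun k => magnusDot A k t) m n := by
  rw [magnusDot_of_two_le A hn]
  congr 1
  refine Finset.sum_congr rfl fun m _ => ?_
  rw [lieConv_eq_sum_positiveTuples (magnusTerm_index_zero A t)
    (by rw [magnusDot_zero]; rfl)]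

variable [CompleteSpace 𝔸]

theorem hasDerivAt_integral_of_continuousOn {f : ℝ → 𝔸} {r t : ℝ}
    (hf : ContinuousOn f (Metric.ball 0 r)) (ht : t ∈ Metric.ball (0 : ℝ) r) :
    HasDerivAt (fun t => ∫ s in (0 : ℝ)..t, f s) (f t) t :=
  intervalIntegral.integral_hasDerivAt_right
    (hf.mono (uIcc_subset_ball_zero ht)).intervalIntegrable
    (hf.stronglyMeasurableAtFilter Metric.isOpen_ball t ht)
    (hf.continuousAt (Metric.isOpen_ball.mem_nhds ht))

theorem continuousOn_magnusDot {A : ℝ → 𝔸} {r : ℝ} (hA : ContinuousOn A (Metric.ball 0 r))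
    (n : ℕ) : ContinuousOn (magnusDot A n) (Metric.ball 0 r) := by
  induction n using Nat.strong_induction_on with
  | _ n ih =>
    rcases Nat.lt_or_ge n 2 with h | h
    · interval_cases n
      · rw [magnusDot_zero]
        exact continuousOn_const
      · rwa [magnusDot_one]
    · rw [funext fun t => magnusDot_of_two_le A h t]
      refine (continuousOn_finsetSum _ fun m hm => ContinuousOn.const_smul
        (continuousOn_finsetSum _ fun v hv => ?_) _).neg
      have hlt := lt_of_mem_positiveTuples (Finset.mem_Icc.1 hm).1 hv
      exact continuousOn_nestedComm (fun i t ht =>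
        (hasDerivAt_integral_of_continuousOn (ih _ (hlt i.castSucc)) ht).continuousAt
          |>.continuousWithinAt) (ih _ (hlt _))

theorem hasDerivAt_magnusTerm {A : ℝ → 𝔸} {r t : ℝ} (hA : ContinuousOn A (Metric.ball 0 r))
    (n : ℕ) (ht : t ∈ Metric.ball (0 : ℝ) r) :
    HasDerivAt (magnusTerm A n) (magnusDot A n t) t :=
  hasDerivAt_integral_of_continuousOn (continuousOn_magnusDot hA n) ht

/-- Near `0` the terms of the Magnus series and their derivatives have a summable majorant. -/
theorem exists_summable_bound_magnus {A : ℝ → 𝔸} (hc : ∀ᶠ t in 𝓝 (0 : ℝ), ContinuousAt A t) :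
    ∃ ρ > 0, ∃ u : ℕ → ℝ, Summable u ∧ ContinuousOn A (Metric.ball 0 ρ) ∧
      ∀ n, ∀ t ∈ Metric.ball (0 : ℝ) ρ, ‖magnusTerm A n t‖ ≤ ρ * u n ∧ ‖magnusDot A n t‖ ≤ u n := by
  obtain ⟨r, hr, hball⟩ := Metric.eventually_nhds_iff.1 hc
  have hA : ContinuousOn A (Metric.ball 0 r) := fun t ht => (hball ht).continuousWithinAt
  obtain ⟨M, hM⟩ := (isCompact_closedBall (0 : ℝ) (r / 2)).exists_bound_of_continuousOn
    (hA.mono (Metric.closedBall_subset_ball (by linarith)))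
  have hM0 : 0 ≤ M := (norm_nonneg _).trans (hM 0 (Metric.mem_closedBall_self (by positivity)))
  -- The first bound stays where `‖A‖ ≤ M`; the second gives `ρ M ≤ 1/8`, the initial condition of
  -- the majorant recursion.
  set ρ := min (r / 2) (1 / (8 * (M + 1)))
  have hρ : 0 < ρ := by positivity
  have hρr : ρ < r := (min_le_left _ _).trans_lt (by linarith)
  have hρM : ρ * M ≤ 1 / 8 := by
    calc ρ * M ≤ 1 / (8 * (M + 1)) * (M + 1) := by
          gcongr
          · exact min_le_right _ _
          · linarith
      _ = 1 / 8 := by field_simp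
  have hmax (n : ℕ) : ∃ T ∈ Metric.closedBall (0 : ℝ) ρ, ∀ t ∈ Metric.closedBall (0 : ℝ) ρ,
      ‖magnusDot A n t‖ ≤ ‖magnusDot A n T‖ :=
    (isCompact_closedBall (0 : ℝ) ρ).exists_isMaxOn ⟨0, Metric.mem_closedBall_self hρ.le⟩
      ((continuousOn_magnusDot hA n).mono (Metric.closedBall_subset_ball hρr)).norm
  choose T hT hTmax using hmax
  -- `ρ` times the maximum of the derivative also bounds the integrated term, so a single sequence
  -- controls every factor of the nested commutators.
  set β : ℕ → ℝ := fun n => ρ * ‖magnusDot A n (T n)‖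
  have hβ (n : ℕ) : 0 ≤ β n := by positivity
  have hterm (n : ℕ) {t : ℝ} (ht : t ∈ Metric.closedBall (0 : ℝ) ρ) : ‖magnusTerm A n t‖ ≤ β n := by
    have ht' : |t| ≤ ρ := by simpa using ht
    have h := intervalIntegral.norm_integral_le_of_norm_le_const (a := 0) (b := t)
      (f := magnusDot A n) (C := ‖magnusDot A n (T n)‖) fun s hs => hTmax n s <| by
        have hs' := (convex_closedBall (0 : ℝ) ρ).ordConnected.uIcc_subset
          (Metric.mem_closedBall_self hρ.le) ht
        exact hs' (Set.uIoc_subset_uIcc hs)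
    rw [sub_zero, mul_comm] at h
    exact h.trans (mul_le_mul_of_nonneg_right ht' (norm_nonneg _))
  have hrec (n : ℕ) (hn : 2 ≤ n) : β n ≤ ∑ m ∈ Finset.Icc 1 (n - 1), (1 / ((m + 1)! : ℝ)) *
      ∑ v ∈ positiveTuples m n, 2 ^ m * ∏ i, β (v i) := by
    simp only [β]
    rw [magnusDot_of_two_le A hn, norm_neg]
    refine (mul_le_mul_of_nonneg_left (norm_sum_le _ _) hρ.le).trans ?_
    rw [Finset.mul_sum]
    refine Finset.sum_le_sum fun m _ => ?_
    rw [norm_smul, mul_left_comm, Real.norm_of_nonneg (by positivity)]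
    refine mul_le_mul_of_nonneg_left ?_ (by positivity)
    refine (mul_le_mul_of_nonneg_left (norm_sum_le _ _) hρ.le).trans ?_
    rw [Finset.mul_sum]
    refine Finset.sum_le_sum fun v _ => ?_
    rw [Fin.prod_univ_castSucc]
    calc _ ≤ ρ * (2 ^ m * ((∏ i : Fin m, β (v i.castSucc)) *
            ‖magnusDot A (v (Fin.last m)) (T (v (Fin.last m)))‖)) := by
          refine mul_le_mul_of_nonneg_left ((norm_nestedComm_le _ _).trans ?_) hρ.le
          gcongr with i
          · exact hterm _ (hT n)
          · exact hTmax _ _ (hT n)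
      _ = _ := by ring
  have h1 : β 1 ≤ 1 / 8 := by
    refine le_trans ?_ hρM
    simp only [β, magnusDot_one]
    gcongr
    exact hM _ (Metric.closedBall_subset_closedBall (min_le_left _ _) (hT 1))
  have hsum : Summable β := by
    rw [← summable_nat_add_iff 1]
    refine summable_of_sum_range_le (c := 1 / 4) (fun n => hβ _) fun N => ?_
    refine le_of_eq_of_le ?_ (sum_Icc_le_of_magnus_recursion hβ h1 hrec N)
    rw [Finset.range_eq_Ico, Finset.sum_Ico_add' β 0 N 1]
    rfl
  refine ⟨ρ, hρ, fun n => ‖magnusDot A n (T n)‖, ?_, hA.mono (Metric.ball_subset_ball hρr.le),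
    fun n t ht => ⟨hterm n (Metric.ball_subset_closedBall ht),
      hTmax n t (Metric.ball_subset_closedBall ht)⟩⟩
  exact (summable_mul_left_iff hρ.ne').1 hsum

/-- Near `0` the Magnus series converges and solves the Magnus equation. -/
theorem exists_hasDerivAt_magnusSeries {A : ℝ → 𝔸}
    (hc : ∀ᶠ t in 𝓝 (0 : ℝ), ContinuousAt A t) :
    ∀ᶠ t in 𝓝 (0 : ℝ), (Summable fun n : ℕ => magnusTerm A (n + 1) t) ∧
      ∃ D, HasDerivAt (magnusSeries A) D t ∧ dexp (magnusSeries A t) D = A t := by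
  obtain ⟨ρ, hρ, u, hu, hA, hbound⟩ := exists_summable_bound_magnus hc
  filter_upwards [Metric.ball_mem_nhds (0 : ℝ) hρ] with t ht
  have hterm : Summable fun n => ‖magnusTerm A n t‖ :=
    .of_nonneg_of_le (fun _ => norm_nonneg _) (fun n => (hbound n t ht).1) (hu.mul_left ρ)
  have hdot : Summable fun n => ‖magnusDot A n t‖ :=
    .of_nonneg_of_le (fun _ => norm_nonneg _) (fun n => (hbound n t ht).2) hu
  refine ⟨(summable_nat_add_iff 1).2 hterm.of_norm, ∑' n, magnusDot A n t, ?_, ?_⟩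
  · have hu1 := (summable_nat_add_iff 1).2 hu
    have h := hasDerivAt_tsum_of_isPreconnected hu1 Metric.isOpen_ball
      (convex_ball (0 : ℝ) ρ).isPreconnected
      (fun n s hs => hasDerivAt_magnusTerm hA (n + 1) hs) (fun n s hs => (hbound (n + 1) s hs).2)
      (Metric.mem_ball_self hρ) (by simp [magnusTerm, summable_zero]) ht
    rw [hdot.of_norm.tsum_eq_zero_add, magnusDot_zero, Pi.zero_apply, zero_add]
    exact h
  · have h := dexp_tsum_eq hterm hdot (magnusTerm_index_zero A t)
      (by rw [magnusDot_zero]; rfl) (by rw [magnusDot_one])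
      fun n hn => magnusDot_eq_lieConv A hn t
    rwa [hterm.of_norm.tsum_eq_zero_add, magnusTerm_index_zero, zero_add] at h

end Magnus

/-! ### Comparison of the propagators and conclusion. -/

/-- Dividing by `t` bounds `f'` away from `0`, continuity forces `f' 0 = 0`, and the mean value
inequality integrates the bound. -/
theorem isBigO_sub_of_isBigO_smul_deriv {E : Type*} [NormedAddCommGroup E] [NormedSpace ℝ E]
    {f f' : ℝ → E} {n : ℕ} (hn : n ≠ 0) (hf : ∀ᶠ t in 𝓝 (0 : ℝ), HasDerivAt f (f' t) t)
    (hc : ContinuousAt f' 0)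
    (h : (fun t : ℝ => t • f' t) =O[𝓝 0] fun t : ℝ => t ^ (n + 1)) :
    (fun t => f t - f 0) =O[𝓝 0] fun t : ℝ => t ^ (n + 1) := by
  obtain ⟨C, hC0, hC⟩ := h.exists_nonneg
  have hbound : ∀ᶠ t in 𝓝 (0 : ℝ), t ≠ 0 → ‖f' t‖ ≤ C * |t| ^ n := by
    filter_upwards [hC.bound] with t ht ht0
    rw [norm_smul, norm_pow, Real.norm_eq_abs, pow_succ', mul_left_comm] at ht
    exact le_of_mul_le_mul_left ht (abs_pos.2 ht0)
  have h0 : f' 0 = 0 := by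
    refine tendsto_nhds_unique (hc.mono_left nhdsWithin_le_nhds)
      (squeeze_zero_norm' (f := f') (a := fun t => C * |t| ^ n) (t₀ := 𝓝[≠] 0) ?_ ?_)
    · filter_upwards [nhdsWithin_le_nhds hbound, self_mem_nhdsWithin] with t ht ht0
      exact ht ht0
    · have : Continuous fun t : ℝ => C * |t| ^ n := by fun_prop
      simpa [hn] using (this.tendsto 0).mono_left nhdsWithin_le_nhds
  obtain ⟨r, hr, hball⟩ := Metric.eventually_nhds_iff_ball.1 (hf.and hbound)
  refine Asymptotics.IsBigO.of_bound C ?_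
  filter_upwards [Metric.ball_mem_nhds (0 : ℝ) hr] with t ht
  have hsub := uIcc_subset_ball_zero ht
  have hle : ∀ s ∈ Set.uIcc 0 t, ‖f' s‖ ≤ C * |t| ^ n := by
    intro s hs
    rcases eq_or_ne s 0 with rfl | hs0
    · rw [h0, norm_zero]
      positivity
    · refine ((hball s (hsub hs)).2 hs0).trans ?_
      have : |s| ≤ |t| := by simpa using Set.abs_sub_left_of_mem_uIcc hs
      gcongr
  have := (convex_uIcc (0 : ℝ) t).norm_image_sub_le_of_norm_hasDerivWithin_le
    (fun s hs => (hball s (hsub hs)).1.hasDerivWithinAt) hle Set.left_mem_uIcc Set.right_mem_uIcc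
  rwa [sub_zero, Real.norm_eq_abs, mul_assoc, ← pow_succ, ← Real.norm_eq_abs, ← norm_pow] at this

section Comparison

variable {𝔸 : Type*} [NormedRing 𝔸] [NormedAlgebra ℝ 𝔸]

theorem WordTree.eval_zero (x : ℕ → 𝔸) (t : WordTree) (j : ℕ) : eval x 0 j t = 0 := by
  induction t generalizing j with
  | nil => rfl
  | node c o z iho ihz => simp [eval, ihz]

variable [CompleteSpace 𝔸]

theorem exp_mul_exp_neg_self (X : 𝔸) : NormedSpace.exp X * NormedSpace.exp (-X) = 1 := by
  let _ := NormedAlgebra.restrictScalars ℚ ℝ 𝔸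
  rw [← NormedSpace.exp_add_of_commute (Commute.neg_right (Commute.refl X)), add_neg_cancel,
    NormedSpace.exp_zero]

theorem exp_neg_mul_exp_self (X : 𝔸) : NormedSpace.exp (-X) * NormedSpace.exp X = 1 := by
  simpa using exp_mul_exp_neg_self (-X)

/-- Strict differentiability at `0` gives `exp f - exp g = (f - g) + o(f - g)`. -/
theorem isBigO_sub_of_isBigO_exp_sub {ι : Type*} {l : Filter ι} {f g : ι → 𝔸} {h : ι → ℝ}
    (hf : Tendsto f l (𝓝 0)) (hg : Tendsto g l (𝓝 0))
    (hfg : (fun i => NormedSpace.exp (f i) - NormedSpace.exp (g i)) =O[l] h) :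
    (fun i => f i - g i) =O[l] h := by
  have h1 := (hasStrictFDerivAt_exp_zero (𝕂 := ℝ) (𝔸 := 𝔸)).isLittleO.comp_tendsto
    (hf.prodMk_nhds hg)
  refine h1.neg_left.right_isBigO_sub.trans (hfg.congr_left fun i => ?_)
  simp

/-- Variation of constants: `exp(-Ω) F` has derivative `exp(-Ω) (F' - A F)` and equals `1` at `0`,
so it is `1 + O(δ^9)`; multiply back by `exp Ω`. -/
theorem exp_magnusSeries_sub_propagatorJet_isBigO {A : ℝ → 𝔸} {α : ℕ → 𝔸}
    (hc : ∀ᶠ t in 𝓝 (0 : ℝ), ContinuousAt A t)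
    (hA : (fun t => A t - ∑ k ∈ Finset.range 8, t ^ k • α k) =O[𝓝 0] fun t : ℝ => t ^ 8) :
    (fun δ => WordTree.propagatorJet (WordTree.scaledLetter α) δ -
      NormedSpace.exp (magnusSeries A δ)) =O[𝓝 0] fun δ : ℝ => δ ^ 9 := by
  have hΩ := exists_hasDerivAt_magnusSeries hc
  set Ω := magnusSeries A
  set F := WordTree.propagatorJet (WordTree.scaledLetter α)
  have hF (t : ℝ) : HasDerivAt F (deriv F t) t :=
    ((WordTree.contDiff_propagatorJet _).differentiable one_ne_zero t).hasDerivAt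
  have hcU : ContinuousAt (fun t => NormedSpace.exp (Ω t)) 0 := by
    obtain ⟨-, D, hD, -⟩ := hΩ.self_of_nhds
    exact hD.normedSpace_exp.continuousAt
  have hcV : ContinuousAt (fun t => NormedSpace.exp (-Ω t)) 0 := by
    obtain ⟨-, D, hD, -⟩ := hΩ.self_of_nhds
    exact hD.fun_neg.normedSpace_exp.continuousAt
  have hV : ∀ᶠ t in 𝓝 (0 : ℝ), HasDerivAt (fun t => NormedSpace.exp (-Ω t) * F t)
      (NormedSpace.exp (-Ω t) * (deriv F t - A t * F t)) t := by
    filter_upwards [hΩ] with t ⟨_, D, hD, hDA⟩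
    have hU := hD.normedSpace_exp
    rw [hDA] at hU
    have hV := hD.fun_neg.normedSpace_exp
    set V' := dexp (-Ω t) (-D) * NormedSpace.exp (-Ω t)
    have hone := hV.fun_mul hU
    simp only [exp_neg_mul_exp_self] at hone
    have hz := hone.unique (hasDerivAt_const t (1 : 𝔸))
    -- Differentiating `exp(-Ω) exp Ω = 1` gives this derivative without evaluating `dexp` at `-Ω`.
    have hV' : V' = -(NormedSpace.exp (-Ω t) * A t) := by
      have := congrArg (· * NormedSpace.exp (-Ω t)) hz
      simp only [add_mul, mul_assoc, exp_mul_exp_neg_self, mul_one, zero_mul] at this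
      exact eq_neg_of_add_eq_zero_left this
    convert hV.fun_mul (hF t) using 1
    rw [hV', mul_sub, neg_mul, mul_assoc]
    abel
  have hcF' : ContinuousAt (deriv F) 0 :=
    ((WordTree.contDiff_propagatorJet _).continuous_deriv le_rfl).continuousAt
  have hsmall : (fun t : ℝ => t • (NormedSpace.exp (-Ω t) * (deriv F t - A t * F t))) =O[𝓝 0]
      fun t : ℝ => t ^ (8 + 1) := by
    refine ((hcV.isBigO_one ℝ).mul (WordTree.smul_deriv_propagatorJet hA)).congr (fun t => ?_)
      fun t => one_mul _
    rw [mul_smul_comm]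
  have h := isBigO_sub_of_isBigO_smul_deriv (n := 8) (by norm_num) hV
    (hcV.mul (hcF'.sub (hc.self_of_nhds.mul (hF 0).continuousAt))) hsmall
  refine ((hcU.isBigO_one ℝ).mul h).congr (fun t => ?_) fun t => one_mul _
  have hF0 : F 0 = 1 := by simp [F, WordTree.propagatorJet, WordTree.eval_zero]
  have hΩ0 : Ω 0 = 0 := magnusSeries_zero A
  rw [hF0, hΩ0, neg_zero, NormedSpace.exp_zero, mul_sub, ← mul_assoc, exp_mul_exp_neg_self]
  simp

end Comparison

theorem mainTheorem5 {𝔸 : Type*} [NormedRing 𝔸] [NormedAlgebra ℝ 𝔸] [CompleteSpace 𝔸]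
    (A : ℝ → 𝔸) (hA : AnalyticAt ℝ A 0) :
    -- the Magnus series converges near `0`, and its exponential is the propagator
    (∀ᶠ t in 𝓝 (0 : ℝ), Summable fun n : ℕ => magnusTerm A (n + 1) t) ∧
    magnusSeries A 0 = 0 ∧
    (∀ᶠ t in 𝓝 (0 : ℝ), HasDerivAt (fun s => NormedSpace.exp (magnusSeries A s))
      (A t * NormedSpace.exp (magnusSeries A t)) t) ∧
    -- the expansion in Legendre coefficients
    (fun δ : ℝ => magnusSeries A δ -
      magnusLegendre (legendreCoeff A δ 1) (legendreCoeff A δ 2)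
        (legendreCoeff A δ 3) (legendreCoeff A δ 4)) =O[𝓝 0] fun δ : ℝ => δ ^ 9 := by
  have hc : ∀ᶠ t in 𝓝 (0 : ℝ), ContinuousAt A t :=
    hA.eventually_analyticAt.mono fun t ht => ht.continuousAt
  have hΩ := exists_hasDerivAt_magnusSeries hc
  refine ⟨hΩ.mono fun t ht => ht.1, magnusSeries_zero A, ?_, ?_⟩
  · filter_upwards [hΩ] with t ⟨_, D, hD, hDA⟩
    simpa only [hDA] using hD.normedSpace_exp
  · obtain ⟨p, hp⟩ := hA
    have hjet : (fun t => A t - ∑ k ∈ Finset.range 8, t ^ k • p.coeff k) =O[𝓝 0]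
        fun t : ℝ => t ^ 8 := by
      have h := hp.isBigO_sub_partialSum_pow 8
      simp only [zero_add, FormalMultilinearSeries.partialSum,
        FormalMultilinearSeries.apply_eq_pow_smul_coeff, ← norm_pow] at h
      exact h.of_norm_right
    have hleg {n : ℕ} (hn : 1 ≤ n) (hn4 : n ≤ 4) :=
      WordTree.represents_legendreCoeff hc hjet hn hn4
    have hθ := (hleg le_rfl (by norm_num)).magnusLegendre (hleg (n := 2) (by norm_num)
      (by norm_num)) (hleg (n := 3) (by norm_num) (by norm_num)) (hleg (n := 4) (by norm_num) le_rfl)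
    set θ : ℝ → 𝔸 := fun δ => magnusLegendre (legendreCoeff A δ 1) (legendreCoeff A δ 2)
      (legendreCoeff A δ 3) (legendreCoeff A δ 4)
    have hN : ((8)! * 15120 ^ 8 : ℝ) ≠ 0 := by positivity
    have hexp : (fun δ => NormedSpace.exp (θ δ) -
        WordTree.propagatorJet (WordTree.scaledLetter p.coeff) δ) =O[𝓝 0] fun δ : ℝ => δ ^ 9 := by
      refine (Asymptotics.IsBigO.const_smul_left hθ.exp_sub_one
        ((8)! * 15120 ^ 8 : ℝ)⁻¹).congr_left fun δ => ?_
      rw [Pi.smul_apply, smul_sub, inv_smul_smul₀ hN, WordTree.propagatorJet, sub_sub]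
    have hθ0 : Tendsto θ (𝓝 0) (𝓝 0) := by
      have := (hθ.isBigO_id.const_smul_left (15120⁻¹ : ℝ)).trans_tendsto tendsto_id
      refine this.congr fun δ => ?_
      simp [θ]
    have hΩ0 : Tendsto (magnusSeries A) (𝓝 0) (𝓝 0) := by
      obtain ⟨-, D, hD, -⟩ := hΩ.self_of_nhds
      simpa [ContinuousAt, magnusSeries_zero] using hD.continuousAt
    refine isBigO_sub_of_isBigO_exp_sub hΩ0 hθ0 ?_
    refine (hexp.add (exp_magnusSeries_sub_propagatorJet_isBigO hc hjet)).neg_left.congr_left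
      fun δ => ?_
    abel

end
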